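/- Let $K\ge 2$, let $\Sigma=\{1,\dots,K\}$, and let $(p_{ik})_{i,k\in\Sigma}$ be the transition matrix of an irreducible, aperiodic Markov chain on $\Sigma$. For $\theta\in\mathbb R$ let $A(\theta)=(p_{ik}^{\theta})_{i,k\in\Sigma}$, with the convention that $p_{ik}^{\theta}=0$ whenever $p_{ik}=0$, even for $\theta\le 0$. Then for every $\theta$ the matrix $A(\theta)$ has a real maximum modulus eigenvalue $\rho(\theta)$ (a simple root of the characteristic polynomial whose modulus is strictly larger than the modulus of every other root), the function $\rho$ is differentiable on $\mathbb R$, and the limit $$C^*:=\lim_{\theta\to\infty}\frac{\rho(\theta)}{-\rho'(\theta)}$$ exists and satisfies $0<C^*<\infty$. Let $Y^{1},Y^{2},\dots$ be independent copies, defined on one probability space, of the Markov chain with transition probabilities $p_{ik}$ started from a fixed state; $Y^{b}_n$ is the type of the box of generation $n$ into which ball $b$ falls, and the boxes of generation $n$ are labelled by the words $u=(u_1,\dots,u_n)\in\Sigma^n$, ball $b$ lying in the box $u$ if $(Y^{b}_1,\dots,Y^{b}_n)=u$. For an integer $m\ge 1$ and a real number $j>0$ let $H_{m,j}$ be the first generation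 $n\ge 0$ at which every box contains strictly less than $j$ of the first $m$ balls. Let $\alpha\in(0,1)$ and $j=j(m)=m^{\alpha}$. Then, almost surely, $H_{m,m^{\alpha}}$ is finite for all $m\ge 2$ and $$\lim_{m\to\infty}\frac{H_{m,m^{\alpha}}}{\ln m}=(1-\alpha)\,C^* .$$ -/

import Mathlib

open Filter Topology MeasureTheory ProbabilityTheory

noncomputable section

/-- The transition matrix `p` is aperiodic: for every state `i`, the greatest common divisor of the
lengths `n ≥ 1` of the possible returns to `i` is `1`. -/
def IsAperiodic {K : ℕ} (p : Matrix (Fin K) (Fin K) ℝ) : Prop :=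
  ∀ (i : Fin K) (d : ℕ), (∀ n : ℕ, 0 < n → 0 < (p ^ n) i i → d ∣ n) → d = 1

/-- The matrix `A(θ) = (p_{ij}^θ)`, with the convention that `p_{ij}^θ = 0` whenever `p_{ij} = 0`,
even for `θ ≤ 0`. -/
def powMatrix {K : ℕ} (p : Matrix (Fin K) (Fin K) ℝ) (θ : ℝ) : Matrix (Fin K) (Fin K) ℝ :=
  Matrix.of fun i j => if p i j = 0 then 0 else p i j ^ θ

/-- The real number `r` is a maximum modulus eigenvalue of the real matrix `A`: it is a simple root
of the characteristic polynomial, and its modulus is strictly larger than the modulus of every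
other complex root. -/
def IsMaxModulusEigenvalue {K : ℕ} (A : Matrix (Fin K) (Fin K) ℝ) (r : ℝ) : Prop :=
  (A.map (algebraMap ℝ ℂ)).charpoly.rootMultiplicity (r : ℂ) = 1 ∧
    ∀ z : ℂ, (A.map (algebraMap ℝ ℂ)).charpoly.IsRoot z → z ≠ (r : ℂ) → ‖z‖ < ‖(r : ℂ)‖

/-- `X` is a Markov chain under `μ` with transition matrix `p`, started from the state `s`. The
Markov property is written for elementary cylinder events, multiplied through by the probability of
the conditioning event. -/
structure IsMarkovChainFrom {K : ℕ} {Ω : Type*} [MeasurableSpace Ω] (μ : Measure Ω)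
    (p : Matrix (Fin K) (Fin K) ℝ) (s : Fin K) (X : ℕ → Ω → Fin K) : Prop where
  measurable : ∀ n, Measurable (X n)
  initial : ∀ᵐ ω ∂μ, X 0 ω = s
  step : ∀ (n : ℕ) (x : ℕ → Fin K),
    μ {ω | ∀ k ≤ n + 1, X k ω = x k} =
      μ {ω | ∀ k ≤ n, X k ω = x k} * ENNReal.ofReal (p (x n) (x (n + 1)))

/-- The number of balls, among the first `m` balls thrown (those with index `b < m`), that lie in
the box labelled by the word `u = (u_1, …, u_n)`, i.e. whose trajectory visits the types
`u_1, …, u_n` at the generations `1, …, n`. Here `Y b k` is the type of the box of generation `k`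
that contains ball `b`. For `n = 0` all the balls are counted. -/
def ballCount {K : ℕ} {Ω : Type*} (Y : ℕ → ℕ → Ω → Fin K) (m : ℕ) {n : ℕ} (u : Fin n → Fin K)
    (ω : Ω) : ℕ :=
  ((Finset.range m).filter fun b => ∀ k : Fin n, Y b (k + 1) ω = u k).card

/-- The set of generations `n` at which, after `m` balls have been thrown, every box contains
strictly less than `j` balls (`j` need not be an integer). -/
def lowGenerations {K : ℕ} {Ω : Type*} (Y : ℕ → ℕ → Ω → Fin K) (m : ℕ) (j : ℝ) (ω : Ω) : Set ℕ :=
  {n | ∀ u : Fin n → Fin K, (ballCount Y m u ω : ℝ) < j}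

/-- The height `H_{m,j}`: the first generation at which, after `m` balls have been thrown, every box
contains strictly less than `j` balls. (If there is no such generation, the value is `0`.) -/
def height {K : ℕ} {Ω : Type*} (Y : ℕ → ℕ → Ω → Fin K) (m : ℕ) (j : ℝ) (ω : Ω) : ℕ :=
  sInf (lowGenerations Y m j ω)

end

/-! ### Perron–Frobenius theory of primitive matrices -/

section Perron

variable {ι : Type*} [Fintype ι]

/-! Everything is governed by one number `l`, the max-times eigenvalue of `p`: there is a positive
vector `h` with max_j p_ij h_j = l h_i for every i, and 0 < l < 1 (`exists_maxTimes_eigenvector`,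
`maxTimes_eigenvalue_lt_one`). The constant is C* = 1/(-log l).

Spectral side. Aperiodicity and irreducibility make `p`, hence every A(θ), primitive, and
Perron–Frobenius gives ρ(θ). Testing A(θ) on the vector h^θ gives l^θ ≤ ρ(θ) ≤ K l^θ for θ ≥ 0.
Since log ρ is convex and differentiable and stays within log K of the line θ log l, its derivative
ρ'/ρ tends to log l (`tendsto_perron_root_div_deriv`).

Probabilistic side. Along a path the factors h telescope, so every box of generation n has
probability at most c l^n, and following the maximising transitions produces a box of probability at
least l^n / c (`exists_box_bounds`). The fullest box thus holds about m l^n balls, which crosses m^α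
near n = (1-α) log m / (-log l). On either side of this threshold a Chernoff bound gives failure
probabilities exponentially small in a power of m. This beats the number K^n of boxes, which is
polynomial in m, and Borel–Cantelli finishes. -/

theorem exists_pos_forall_mul_le {u : ι → ℝ} (v : ι → ℝ) (hu : ∀ i, 0 < u i) :
    ∃ ε > 0, ∀ i, ε * v i ≤ u i := by
  rcases isEmpty_or_nonempty ι with h | h
  · exact ⟨1, one_pos, fun i => h.elim i⟩
  obtain ⟨i₀, hi₀⟩ := Finite.exists_min fun i => u i / (|v i| + 1)
  have hpos : ∀ i, 0 < |v i| + 1 := fun i => by positivity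
  refine ⟨u i₀ / (|v i₀| + 1), div_pos (hu _) (hpos _), fun i => ?_⟩
  have h1 : u i₀ / (|v i₀| + 1) * (|v i| + 1) ≤ u i := by
    rw [← le_div_iff₀ (hpos i)]
    exact hi₀ i
  have h2 : u i₀ / (|v i₀| + 1) * v i ≤ u i₀ / (|v i₀| + 1) * (|v i| + 1) :=
    mul_le_mul_of_nonneg_left (by linarith [le_abs_self (v i)]) (div_pos (hu _) (hpos _)).le
  exact h2.trans h1

theorem Matrix.mulVec_pos_of_pos {B : Matrix ι ι ℝ} (hB : ∀ i j, 0 < B i j) {x : ι → ℝ}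
    (hx : ∀ i, 0 ≤ x i) (hx0 : x ≠ 0) (i : ι) : 0 < (B.mulVec x) i := by
  obtain ⟨j, hj⟩ := Function.ne_iff.1 hx0
  refine Finset.sum_pos' (fun k _ => mul_nonneg (hB i k).le (hx k)) ⟨j, Finset.mem_univ j, ?_⟩
  exact mul_pos (hB i j) (lt_of_le_of_ne (hx j) (Ne.symm hj))

theorem ne_zero_of_mem_stdSimplex {x : ι → ℝ} (hx : x ∈ stdSimplex ℝ ι) : x ≠ 0 := by
  rintro rfl
  simpa using hx.2

theorem Matrix.dotProduct_mulVec_left_eigen {R : Type*} [CommSemiring R] {B : Matrix ι ι R}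
    {y : ι → R} {r : R} (h : B.transpose.mulVec y = r • y) (v : ι → R) :
    y ⬝ᵥ B.mulVec v = r * (y ⬝ᵥ v) := by
  rw [Matrix.dotProduct_mulVec, ← Matrix.mulVec_transpose, h, smul_dotProduct, smul_eq_mul]

theorem eigenvalue_eq_sum_mulVec {B : Matrix ι ι ℝ} {v : ι → ℝ} {r : ℝ} (hv : v ∈ stdSimplex ℝ ι)
    (h : B.mulVec v = r • v) : r = ∑ i, (B.mulVec v) i := by
  simp [h, ← Finset.mul_sum, hv.2]

variable [DecidableEq ι]

theorem Matrix.pow_mulVec_of_eigen {R : Type*} [CommSemiring R] {B : Matrix ι ι R} {v : ι → R}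
    {z : R} (h : B.mulVec v = z • v) (n : ℕ) : (B ^ n).mulVec v = z ^ n • v := by
  induction n with
  | zero => simp
  | succ n ih => rw [pow_succ, ← Matrix.mulVec_mulVec, h, Matrix.mulVec_smul, ih, smul_smul, pow_succ,
      mul_comm]

namespace Matrix.IsPrimitive

variable {A : Matrix ι ι ℝ}

theorem transpose (hA : A.IsPrimitive) : A.transpose.IsPrimitive := by
  obtain ⟨N, hN, h⟩ := hA.exists_pos_pow
  refine ⟨fun i j => hA.nonneg j i, N, hN, fun i j => ?_⟩
  rw [← Matrix.transpose_pow]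
  exact h j i

/-- A strictly positive power sends x to t^N x, so all t^N x_i are positive; this excludes t = 0 and
any zero entry. -/
theorem eigenvector_pos (hA : A.IsPrimitive) {x : ι → ℝ} {t : ℝ} (hx : x ∈ stdSimplex ℝ ι)
    (h : A.mulVec x = t • x) : 0 < t ∧ ∀ i, 0 < x i := by
  obtain ⟨N, hN, hpos⟩ := hA.exists_pos_pow
  have ht0 : 0 ≤ t := by
    have : t = ∑ i, (A.mulVec x) i := by simp [h, ← Finset.mul_sum, hx.2]
    rw [this]
    exact Finset.sum_nonneg fun i _ => Finset.sum_nonneg fun j _ => mul_nonneg (hA.nonneg i j) (hx.1 j)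
  have key : ∀ i, 0 < t ^ N * x i := fun i => by
    have := Matrix.mulVec_pos_of_pos hpos hx.1 (ne_zero_of_mem_stdSimplex hx) i
    rwa [Matrix.pow_mulVec_of_eigen h] at this
  refine ⟨ht0.lt_of_ne ?_, fun i => pos_of_mul_pos_right (key i) (pow_nonneg ht0 N)⟩
  rintro rfl
  obtain ⟨i, -⟩ := Function.ne_iff.1 (ne_zero_of_mem_stdSimplex hx)
  simpa [hN.ne'] using key i

/-- Collatz–Wielandt variational argument: maximise r over the compact set of pairs with r x ≤ A x.
If the defect A x - r x were nonzero, A^N would make it strictly positive, and the normalised A^N x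
would allow r + ε. -/
theorem exists_eigenvector [Nonempty ι] (hA : A.IsPrimitive) :
    ∃ x ∈ stdSimplex ℝ ι, ∃ r : ℝ, A.mulVec x = r • x := by
  obtain ⟨N, hN, hpos⟩ := hA.exists_pos_pow
  set T : ℝ := ∑ i, ∑ j, A i j with hT
  have hbound : ∀ (t : ℝ) (x : ι → ℝ), x ∈ stdSimplex ℝ ι → (∀ i, t * x i ≤ (A.mulVec x) i) → t ≤ T := by
    intro t x hx h
    calc t = ∑ i, t * x i := by rw [← Finset.mul_sum, hx.2, mul_one]
      _ ≤ ∑ i, ∑ j, A i j * x j := Finset.sum_le_sum fun i _ => h i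
      _ ≤ T := by
        refine Finset.sum_le_sum fun i _ => Finset.sum_le_sum fun j _ => ?_
        refine mul_le_of_le_one_right (hA.nonneg i j) ?_
        rw [← hx.2]
        exact Finset.single_le_sum (fun k _ => hx.1 k) (Finset.mem_univ j)
  let S : Set (ℝ × (ι → ℝ)) :=
    (Set.Icc 0 T ×ˢ stdSimplex ℝ ι) ∩ {q | ∀ i, q.1 * q.2 i ≤ (A.mulVec q.2) i}
  have hS : IsCompact S := by
    refine (isCompact_Icc.prod (isCompact_stdSimplex ℝ ι)).inter_right ?_
    simp only [Set.ofPred_forall]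
    refine isClosed_iInter fun i => isClosed_le (by fun_prop) ?_
    simp only [Matrix.mulVec, dotProduct]
    fun_prop
  have hTnonneg : 0 ≤ T := Finset.sum_nonneg fun i _ => Finset.sum_nonneg fun j _ => hA.nonneg i j
  have hne : S.Nonempty := by
    obtain ⟨i⟩ := ‹Nonempty ι›
    refine ⟨(0, Pi.single i 1), ⟨⟨le_rfl, hTnonneg⟩, single_mem_stdSimplex ℝ i⟩, fun k => ?_⟩
    rw [zero_mul]
    exact Finset.sum_nonneg fun j _ => mul_nonneg (hA.nonneg k j) ((single_mem_stdSimplex ℝ i).1 j)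
  obtain ⟨⟨r, x⟩, ⟨⟨⟨hr0, -⟩, hx⟩, hrx⟩, hmax⟩ := hS.exists_isMaxOn hne continuous_fst.continuousOn
  refine ⟨x, hx, r, ?_⟩
  by_contra hneq
  simp only at hr0 hx hrx
  set d : ι → ℝ := A.mulVec x - r • x with hd
  have hd0 : d ≠ 0 := sub_ne_zero.2 hneq
  have hdn : ∀ i, 0 ≤ d i := fun i => by simpa [hd] using hrx i
  set y := (A ^ N).mulVec x with hy
  have hy_pos : ∀ i, 0 < y i := Matrix.mulVec_pos_of_pos hpos hx.1 (ne_zero_of_mem_stdSimplex hx)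
  have hAd : (A ^ N).mulVec d = A.mulVec y - r • y := by
    rw [hd, hy, Matrix.mulVec_sub, Matrix.mulVec_smul, Matrix.mulVec_mulVec, Matrix.mulVec_mulVec,
      ← pow_succ, ← pow_succ']
  obtain ⟨ε, hε, hεy⟩ := exists_pos_forall_mul_le y (Matrix.mulVec_pos_of_pos hpos hdn hd0)
  have hs : 0 < ∑ i, y i := Finset.sum_pos (fun i _ => hy_pos i) Finset.univ_nonempty
  have hmem : (∑ i, y i)⁻¹ • y ∈ stdSimplex ℝ ι := by
    refine ⟨fun i => mul_nonneg (inv_nonneg.2 hs.le) (hy_pos i).le, ?_⟩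
    simp only [Pi.smul_apply, smul_eq_mul, ← Finset.mul_sum]
    exact inv_mul_cancel₀ hs.ne'
  have hsup : ∀ i, (r + ε) * ((∑ i, y i)⁻¹ • y) i ≤ (A.mulVec ((∑ i, y i)⁻¹ • y)) i := by
    intro i
    rw [Matrix.mulVec_smul]
    simp only [Pi.smul_apply, smul_eq_mul]
    rw [mul_left_comm]
    refine mul_le_mul_of_nonneg_left ?_ (inv_nonneg.2 hs.le)
    have := hεy i
    rw [hAd] at this
    simp only [Pi.sub_apply, Pi.smul_apply, smul_eq_mul] at this
    linarith
  have hin : (r + ε, (∑ i, y i)⁻¹ • y) ∈ S :=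
    ⟨⟨⟨by positivity, hbound _ _ hmem hsup⟩, hmem⟩, hsup⟩
  have : r + ε ≤ r := hmax hin
  linarith

/-- A vector annihilated by the positive left eigenvector has a strictly smaller growth rate. -/
theorem norm_lt_of_dotProduct_eq_zero (hA : A.IsPrimitive) {x y : ι → ℝ} {r : ℝ}
    (hr : 0 < r) (hx : ∀ i, 0 < x i) (hy : ∀ i, 0 < y i) (hAx : A.mulVec x = r • x)
    {v : ι → ℂ} {z : ℂ} (hv : v ≠ 0) (hAv : (A.map (algebraMap ℝ ℂ)).mulVec v = z • v)
    (hyv : ∑ j, (y j : ℂ) * v j = 0) : ‖z‖ < r := by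
  obtain ⟨N, hN, hpos⟩ := hA.exists_pos_pow
  -- A^N - δ x yᵀ is still entrywise nonnegative and acts on v as A^N does, because y annihilates v;
  -- but its eigenvalue at x drops from r^N to r^N - δ (y·x).
  obtain ⟨δ, hδ, hδle⟩ := exists_pos_forall_mul_le (ι := ι × ι) (u := fun q => (A ^ N) q.1 q.2)
    (fun q => x q.1 * y q.2) (fun q => hpos q.1 q.2)
  obtain ⟨j₀, hj₀⟩ := Function.ne_iff.1 hv
  have : Nonempty ι := ⟨j₀⟩
  -- The growth of v is measured in the sup norm weighted by x, at the index attaining it.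
  obtain ⟨i, hi⟩ := Finite.exists_max fun i => ‖v i‖ / x i
  have hvi : 0 < ‖v i‖ / x i := lt_of_lt_of_le (div_pos (norm_pos_iff.2 hj₀) (hx j₀)) (hi j₀)
  set M := ‖v i‖ / x i with hM
  have hvM : ∀ j, ‖v j‖ ≤ M * x j := fun j => (div_le_iff₀ (hx j)).1 (hi j)
  have hxy : 0 < ∑ j, y j * x j := Finset.sum_pos (fun j _ => mul_pos (hy j) (hx j)) Finset.univ_nonempty
  have hNx : ∑ j, (A ^ N) i j * x j = r ^ N * x i := by
    have := congrFun (Matrix.pow_mulVec_of_eigen hAx N) i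
    simpa [Matrix.mulVec, dotProduct] using this
  have hNv : ∑ j, ((A ^ N) i j : ℂ) * v j = z ^ N * v i := by
    have := congrFun (Matrix.pow_mulVec_of_eigen hAv N) i
    rw [← Matrix.map_pow] at this
    simpa [Matrix.mulVec, dotProduct] using this
  have hB : z ^ N * v i = ∑ j, (((A ^ N) i j - δ * (x i * y j) : ℝ) : ℂ) * v j := by
    rw [← hNv]
    have : ∑ j, (((A ^ N) i j - δ * (x i * y j) : ℝ) : ℂ) * v j
        = ∑ j, ((A ^ N) i j : ℂ) * v j - δ * x i * ∑ j, (y j : ℂ) * v j := by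
      rw [Finset.mul_sum, ← Finset.sum_sub_distrib]
      refine Finset.sum_congr rfl fun j _ => ?_
      push_cast
      ring
    rw [this, hyv, mul_zero, sub_zero]
  have hle : ‖z‖ ^ N * ‖v i‖ ≤ M * ((r ^ N - δ * ∑ j, y j * x j) * x i) := by
    rw [← norm_pow, ← norm_mul, hB]
    refine (norm_sum_le _ _).trans ?_
    calc ∑ j, ‖(((A ^ N) i j - δ * (x i * y j) : ℝ) : ℂ) * v j‖
        ≤ ∑ j, ((A ^ N) i j - δ * (x i * y j)) * (M * x j) := by
          refine Finset.sum_le_sum fun j _ => ?_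
          have h0 : 0 ≤ (A ^ N) i j - δ * (x i * y j) := sub_nonneg.2 (hδle (i, j))
          rw [norm_mul, Complex.norm_real, Real.norm_of_nonneg h0]
          exact mul_le_mul_of_nonneg_left (hvM j) h0
      _ = M * (∑ j, (A ^ N) i j * x j - δ * (∑ j, y j * x j) * x i) := by
          rw [Finset.mul_sum, Finset.sum_mul, ← Finset.sum_sub_distrib, Finset.mul_sum]
          refine Finset.sum_congr rfl fun j _ => ?_
          ring
      _ = M * ((r ^ N - δ * ∑ j, y j * x j) * x i) := by rw [hNx]; ring
  have hviM : ‖v i‖ = M * x i := by rw [hM, div_mul_cancel₀ _ (hx i).ne']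
  rw [hviM] at hle
  have hpw : ‖z‖ ^ N ≤ r ^ N - δ * ∑ j, y j * x j := by
    have h2 : 0 < M * x i := mul_pos hvi (hx i)
    nlinarith
  have : ‖z‖ ^ N < r ^ N := by nlinarith [mul_pos hδ hxy]
  exact lt_of_pow_lt_pow_left₀ N hr.le this

/-- Two nonnegative normalised eigenvectors of a primitive matrix coincide. -/
theorem eigenvector_unique [Nonempty ι] (hA : A.IsPrimitive) {x x' : ι → ℝ} {r r' : ℝ}
    (hx : x ∈ stdSimplex ℝ ι) (hx' : x' ∈ stdSimplex ℝ ι) (h : A.mulVec x = r • x)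
    (h' : A.mulVec x' = r' • x') : r' = r ∧ x' = x := by
  obtain ⟨y, hy, t, hyt⟩ := hA.transpose.exists_eigenvector
  have hyp := (hA.transpose.eigenvector_pos hy hyt).2
  have key : ∀ {w : ι → ℝ} {s : ℝ}, w ∈ stdSimplex ℝ ι → A.mulVec w = s • w → s = t := by
    intro w s hw hs
    have hpos : 0 < y ⬝ᵥ w := Finset.sum_pos
      (fun j _ => mul_pos (hyp j) ((hA.eigenvector_pos hw hs).2 j)) Finset.univ_nonempty
    have := dotProduct_mulVec_left_eigen hyt w
    rw [hs, dotProduct_smul, smul_eq_mul] at this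
    exact mul_right_cancel₀ hpos.ne' this
  have hrt := key hx h
  have hrt' := key hx' h'
  subst hrt
  refine ⟨hrt', ?_⟩
  rw [hrt'] at h'
  by_contra hne
  obtain ⟨hr, hxp⟩ := hA.eigenvector_pos hx h
  have hyx : 0 < y ⬝ᵥ x := Finset.sum_pos (fun j _ => mul_pos (hyp j) (hxp j)) Finset.univ_nonempty
  -- Removing the x-component of x' leaves an eigenvector for r annihilated by y; were it nonzero,
  -- strict domination would give r < r.
  set c := (y ⬝ᵥ x') / (y ⬝ᵥ x) with hc
  set w : ι → ℝ := x' - c • x with hw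
  have hAw : A.mulVec w = r • w := by
    rw [hw, Matrix.mulVec_sub, Matrix.mulVec_smul, h, h', smul_sub, smul_comm]
  have hyw : y ⬝ᵥ w = 0 := by
    rw [hw, dotProduct_sub, dotProduct_smul, smul_eq_mul, hc, div_mul_cancel₀ _ hyx.ne', sub_self]
  have hw0 : w ≠ 0 := by
    intro h0
    have hxc : x' = c • x := sub_eq_zero.1 h0
    have : c = 1 := by
      have h2 := hx'.2
      rw [hxc] at h2
      simpa [← Finset.mul_sum, hx.2] using h2
    exact hne (by rw [hxc, this, one_smul])
  have := hA.norm_lt_of_dotProduct_eq_zero (v := fun i => (w i : ℂ)) (z := (r : ℂ)) hr hxp hyp h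
    (fun h0 => hw0 (funext fun i => by simpa using congrFun h0 i)) ?_ ?_
  · simp [abs_of_pos hr] at this
  · ext i
    have := congrFun hAw i
    simp only [Matrix.mulVec, dotProduct, Pi.smul_apply, smul_eq_mul] at this ⊢
    simp only [Matrix.map_apply, Complex.coe_algebraMap]
    exact_mod_cast this
  · simp only [dotProduct] at hyw
    exact_mod_cast hyw

/-- The Perron–Frobenius theorem: the Perron root is simple and strictly dominant. -/
theorem charpoly_perron [Nonempty ι] (hA : A.IsPrimitive) {x : ι → ℝ} {r : ℝ}
    (hx : x ∈ stdSimplex ℝ ι) (h : A.mulVec x = r • x) :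
    (A.map (algebraMap ℝ ℂ)).charpoly.rootMultiplicity (r : ℂ) = 1 ∧
      ∀ z : ℂ, (A.map (algebraMap ℝ ℂ)).charpoly.IsRoot z → z ≠ (r : ℂ) → ‖z‖ < ‖(r : ℂ)‖ := by
  obtain ⟨y, hy, t, hyt⟩ := hA.transpose.exists_eigenvector
  have hyp := (hA.transpose.eigenvector_pos hy hyt).2
  obtain ⟨hr, hxp⟩ := hA.eigenvector_pos hx h
  have hyx : 0 < y ⬝ᵥ x := Finset.sum_pos (fun j _ => mul_pos (hyp j) (hxp j)) Finset.univ_nonempty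
  have htr : t = r := by
    have := dotProduct_mulVec_left_eigen hyt x
    rw [h, dotProduct_smul, smul_eq_mul] at this
    exact (mul_right_cancel₀ hyx.ne' this).symm
  subst htr
  set B : Matrix ι ι ℂ := A.map (algebraMap ℝ ℂ) with hB
  set yc : ι → ℂ := fun i => y i with hyc
  set xc : ι → ℂ := fun i => x i with hxc
  have hBx : B.mulVec xc = (t : ℂ) • xc := by
    ext i
    have := congrFun h i
    simp only [Matrix.mulVec, dotProduct, Pi.smul_apply, smul_eq_mul] at this ⊢
    simp only [hB, hxc, Matrix.map_apply, Complex.coe_algebraMap]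
    exact_mod_cast this
  have hBy : B.transpose.mulVec yc = (t : ℂ) • yc := by
    ext i
    have := congrFun hyt i
    simp only [Matrix.mulVec, dotProduct, Pi.smul_apply, smul_eq_mul] at this ⊢
    simp only [hB, hyc, Matrix.map_apply, Matrix.transpose_apply, Complex.coe_algebraMap] at this ⊢
    exact_mod_cast this
  have hycx : yc ⬝ᵥ xc ≠ 0 := by
    have : yc ⬝ᵥ xc = ((y ⬝ᵥ x : ℝ) : ℂ) := by simp [dotProduct, hyc, hxc]
    rw [this]
    exact_mod_cast hyx.ne'
  have hdom : ∀ {z : ℂ} {v : ι → ℂ}, v ≠ 0 → B.mulVec v = z • v → yc ⬝ᵥ v = 0 → ‖z‖ < t :=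
    fun hv hz h0 => hA.norm_lt_of_dotProduct_eq_zero hr hxp hyp h hv hz h0
  constructor
  · rw [← Matrix.charpoly_toLin', ← LinearMap.finrank_maxGenEigenspace_eq, finrank_eq_one_iff']
    -- The hyperplane annihilated by y is invariant and contains no eigenvector for t, so B - t and
    -- all its powers are injective on it. The generalised eigenspace is then the line through x.
    have hkill : ∀ (k : ℕ) (v : ι → ℂ), yc ⬝ᵥ v = 0 →
        ((Matrix.toLin' B - algebraMap ℂ _ (t : ℂ)) ^ k) v = 0 → v = 0 := by
      intro k
      induction k with
      | zero => intro v _ hv; simpa using hv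
      | succ k ih =>
        intro v hv0 hv
        rw [pow_succ, Module.End.mul_apply] at hv
        have hz := ih _ ?_ hv
        · by_contra hne
          have hBv : B.mulVec v = (t : ℂ) • v := by
            simpa [sub_eq_zero, Module.algebraMap_end_apply] using hz
          have := hdom hne hBv hv0
          simp [abs_of_pos hr] at this
        · simp only [LinearMap.sub_apply, Matrix.toLin'_apply, Module.algebraMap_end_apply,
            dotProduct_sub, dotProduct_mulVec_left_eigen hBy, dotProduct_smul, hv0]
          simp
    have hxmem : ∀ k : ℕ, 0 < k → ((Matrix.toLin' B - algebraMap ℂ _ (t : ℂ)) ^ k) xc = 0 := by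
      intro k hk
      obtain ⟨k, rfl⟩ := Nat.exists_eq_succ_of_ne_zero hk.ne'
      rw [Nat.succ_eq_add_one, pow_succ, Module.End.mul_apply]
      have : (Matrix.toLin' B - algebraMap ℂ _ (t : ℂ)) xc = 0 := by
        simp [hBx, Module.algebraMap_end_apply]
      rw [this, map_zero]
    refine ⟨⟨xc, ?_⟩, ?_, ?_⟩
    · rw [Module.End.mem_maxGenEigenspace]
      exact ⟨1, by simpa using hxmem 1 one_pos⟩
    · intro h0
      have h0' : xc = 0 := congrArg Subtype.val h0
      exact hycx (by simp [h0'])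
    · rintro ⟨w, hw⟩
      refine ⟨(yc ⬝ᵥ w) / (yc ⬝ᵥ xc), Subtype.ext ?_⟩
      rw [Module.End.mem_maxGenEigenspace] at hw
      obtain ⟨k, hk⟩ := hw
      -- The exponent k + 1 ensures that x is killed even when k = 0.
      have := hkill (k + 1) (w - ((yc ⬝ᵥ w) / (yc ⬝ᵥ xc)) • xc) ?_ ?_
      · exact (sub_eq_zero.1 this).symm
      · rw [dotProduct_sub, dotProduct_smul, smul_eq_mul, div_mul_cancel₀ _ hycx, sub_self]
      · rw [map_sub, map_smul, hxmem _ k.succ_pos, smul_zero, sub_zero, pow_succ', Module.End.mul_apply]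
        have : ((Matrix.toLin' B - algebraMap ℂ _ (t : ℂ)) ^ k) w = 0 := hk
        rw [this, map_zero]
  · intro z hz hzr
    rw [← Matrix.charpoly_toLin', ← Module.End.hasEigenvalue_iff_isRoot_charpoly] at hz
    obtain ⟨v, hv⟩ := hz.exists_hasEigenvector
    have hBv : B.mulVec v = z • v := by simpa using hv.apply_eq_smul
    have h0 : yc ⬝ᵥ v = 0 := by
      have := dotProduct_mulVec_left_eigen hBy v
      rw [hBv, dotProduct_smul, smul_eq_mul] at this
      exact (mul_eq_mul_right_iff.1 this).resolve_left hzr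
    have := hdom hv.2 hBv h0
    simpa [abs_of_pos hr] using this

end Matrix.IsPrimitive

end Perron

/-! ### The Perron root as a function of a parameter -/

section PerronFamily

variable {ι : Type*} [Fintype ι] [DecidableEq ι] [Nonempty ι]

namespace Matrix.IsPrimitive

variable {A : Matrix ι ι ℝ} {x : ι → ℝ} {r : ℝ}

theorem exists_left_eigenvector (hA : A.IsPrimitive) (hx : x ∈ stdSimplex ℝ ι)
    (h : A.mulVec x = r • x) :
    ∃ y : ι → ℝ, (∀ i, 0 < y i) ∧ A.transpose.mulVec y = r • y := by
  obtain ⟨y, hy, t, hyt⟩ := hA.transpose.exists_eigenvector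
  have hyp := (hA.transpose.eigenvector_pos hy hyt).2
  have hyx : 0 < y ⬝ᵥ x := Finset.sum_pos
    (fun j _ => mul_pos (hyp j) ((hA.eigenvector_pos hx h).2 j)) Finset.univ_nonempty
  have htr : t = r := by
    have := dotProduct_mulVec_left_eigen hyt x
    rw [h, dotProduct_smul, smul_eq_mul] at this
    exact (mul_right_cancel₀ hyx.ne' this).symm
  exact ⟨y, hyp, htr ▸ hyt⟩

/-- Collatz–Wielandt upper bound. -/
theorem eigenvalue_le (hA : A.IsPrimitive) (hx : x ∈ stdSimplex ℝ ι) (h : A.mulVec x = r • x)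
    {w : ι → ℝ} (hw : ∀ i, 0 < w i) {t : ℝ} (hle : ∀ i, ∑ j, A i j * w j ≤ t * w i) : r ≤ t := by
  obtain ⟨y, hy, hyr⟩ := hA.exists_left_eigenvector hx h
  have hyw : 0 < y ⬝ᵥ w := Finset.sum_pos (fun j _ => mul_pos (hy j) (hw j)) Finset.univ_nonempty
  refine le_of_mul_le_mul_right ?_ hyw
  rw [← dotProduct_mulVec_left_eigen hyr w]
  simp only [dotProduct, Finset.mul_sum, Matrix.mulVec]
  refine Finset.sum_le_sum fun i _ => ?_
  rw [← Finset.mul_sum, mul_left_comm]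
  exact mul_le_mul_of_nonneg_left (hle i) (hy i).le

/-- Collatz–Wielandt lower bound. -/
theorem le_eigenvalue (hA : A.IsPrimitive) (hx : x ∈ stdSimplex ℝ ι) (h : A.mulVec x = r • x)
    {w : ι → ℝ} (hw : ∀ i, 0 < w i) {t : ℝ} (hle : ∀ i, t * w i ≤ ∑ j, A i j * w j) : t ≤ r := by
  obtain ⟨y, hy, hyr⟩ := hA.exists_left_eigenvector hx h
  have hyw : 0 < y ⬝ᵥ w := Finset.sum_pos (fun j _ => mul_pos (hy j) (hw j)) Finset.univ_nonempty
  refine le_of_mul_le_mul_right ?_ hyw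
  rw [← dotProduct_mulVec_left_eigen hyr w]
  simp only [dotProduct, Finset.mul_sum, Matrix.mulVec]
  refine Finset.sum_le_sum fun i _ => ?_
  rw [← Finset.mul_sum, mul_left_comm]
  exact mul_le_mul_of_nonneg_left (hle i) (hy i).le

end Matrix.IsPrimitive

variable {A : ℝ → Matrix ι ι ℝ} {x : ℝ → ι → ℝ} {ρ : ℝ → ℝ}

/-- By compactness of the simplex it suffices that every cluster point of x at θ is a normalised
eigenvector of A(θ), hence x(θ) by uniqueness. Writing the eigenvalue as the sum of the entries of A
x avoids assuming ρ continuous. -/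
theorem continuous_perron_vector (hA : ∀ θ, (A θ).IsPrimitive) (hc : Continuous A)
    (hx : ∀ θ, x θ ∈ stdSimplex ℝ ι) (h : ∀ θ, (A θ).mulVec (x θ) = ρ θ • x θ) :
    Continuous x := by
  rw [continuous_iff_continuousAt]
  intro θ
  refine (isCompact_stdSimplex ℝ ι).tendsto_nhds_of_unique_mapClusterPt (Eventually.of_forall hx) ?_
  intro v hv hcl
  obtain ⟨U, hU, hUv⟩ := mapClusterPt_iff_ultrafilter.1 hcl
  have hAU : Tendsto A U (𝓝 (A θ)) := hc.continuousAt.mono_left hU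
  have hmul : Tendsto (fun t => (A t).mulVec (x t)) U (𝓝 ((A θ).mulVec v)) := by
    have hcont : Continuous fun q : Matrix ι ι ℝ × (ι → ℝ) => q.1.mulVec q.2 := by fun_prop
    exact (hcont.tendsto (A θ, v)).comp (hAU.prodMk_nhds hUv)
  have hsum : Tendsto (fun t => (∑ i, ((A t).mulVec (x t)) i) • x t) U
      (𝓝 ((∑ i, ((A θ).mulVec v) i) • v)) := by
    refine Tendsto.smul (tendsto_finsetSum _ fun i _ => ?_) hUv
    exact (continuous_apply i).continuousAt.tendsto.comp hmul
  have heq : (fun t => (∑ i, ((A t).mulVec (x t)) i) • x t) = fun t => (A t).mulVec (x t) := by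
    funext t
    rw [← eigenvalue_eq_sum_mulVec (hx t) (h t), h t]
  rw [heq] at hsum
  have hlim := tendsto_nhds_unique hmul hsum
  exact ((hA θ).eigenvector_unique (hx θ) hv (h θ) hlim).2

/-- With y a left eigenvector at the fixed θ, (ρ(t) - ρ(θ)) y·x(t) = y·(A(t) - A(θ)) x(t) holds
exactly, so the difference quotient converges as soon as x is continuous. -/
theorem differentiable_perron_root (hA : ∀ θ, (A θ).IsPrimitive)
    (hd : ∀ i j, Differentiable ℝ fun θ => A θ i j)
    (hx : ∀ θ, x θ ∈ stdSimplex ℝ ι) (h : ∀ θ, (A θ).mulVec (x θ) = ρ θ • x θ) :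
    Differentiable ℝ ρ := by
  intro θ
  have hcA : Continuous A :=
    continuous_pi fun i => continuous_pi fun j => (hd i j).continuous
  have hcx := continuous_perron_vector hA hcA hx h
  obtain ⟨y, hy, hyr⟩ := (hA θ).exists_left_eigenvector (hx θ) (h θ)
  have hyx : ∀ t, 0 < y ⬝ᵥ x t := fun t => Finset.sum_pos
    (fun j _ => mul_pos (hy j) (((hA t).eigenvector_pos (hx t) (h t)).2 j)) Finset.univ_nonempty
  have hslope : ∀ t, slope ρ θ t =
      (∑ i, ∑ j, y i * slope (fun t => A t i j) θ t * x t j) / (y ⬝ᵥ x t) := by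
    intro t
    rw [eq_div_iff (hyx t).ne', slope_def_field]
    have h1 : ρ t * (y ⬝ᵥ x t) = y ⬝ᵥ (A t).mulVec (x t) := by
      rw [h t, dotProduct_smul, smul_eq_mul]
    have h2 := Matrix.dotProduct_mulVec_left_eigen hyr (x t)
    rw [div_mul_eq_mul_div, sub_mul, h1, ← h2]
    simp only [dotProduct, Matrix.mulVec, Finset.mul_sum, slope_def_field]
    rw [← Finset.sum_sub_distrib, Finset.sum_div]
    refine Finset.sum_congr rfl fun i _ => ?_
    rw [← Finset.sum_sub_distrib, Finset.sum_div]
    refine Finset.sum_congr rfl fun j _ => ?_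
    ring
  have hlim : Tendsto (slope ρ θ) (𝓝[≠] θ)
      (𝓝 ((∑ i, ∑ j, y i * deriv (fun t => A t i j) θ * x θ j) / (y ⬝ᵥ x θ))) := by
    rw [show slope ρ θ = _ from funext hslope]
    have hxt : Tendsto x (𝓝[≠] θ) (𝓝 (x θ)) := hcx.continuousAt.mono_left nhdsWithin_le_nhds
    have hxj : ∀ j, Tendsto (fun t => x t j) (𝓝[≠] θ) (𝓝 (x θ j)) := fun j =>
      (continuous_apply j).continuousAt.tendsto.comp hxt
    refine Tendsto.div ?_ ?_ (hyx θ).ne'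
    · refine tendsto_finsetSum _ fun i _ => tendsto_finsetSum _ fun j _ => ?_
      exact (((hasDerivAt_iff_tendsto_slope.1 (hd i j θ).hasDerivAt)).const_mul (y i)).mul (hxj j)
    · exact tendsto_finsetSum _ fun j _ => (hxj j).const_mul (y j)
  exact (hasDerivAt_iff_tendsto_slope.2 hlim).differentiableAt

end PerronFamily

/-! ### The matrices of powers -/

section PowMatrix

theorem isPrimitive_of_isAperiodic {K : ℕ} {p : Matrix (Fin K) (Fin K) ℝ}
    (hirr : p.IsIrreducible) (haper : IsAperiodic p) : p.IsPrimitive := by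
  have hnn := hirr.nonneg
  have hpow : ∀ n i j, 0 ≤ (p ^ n) i j := fun n i j => Matrix.pow_apply_nonneg hnn n i j
  have hmul : ∀ {a b : ℕ} {i j k : Fin K}, 0 < (p ^ a) i j → 0 < (p ^ b) j k →
      0 < (p ^ (a + b)) i k := by
    intro a b i j k h1 h2
    rw [pow_add, Matrix.mul_apply]
    exact Finset.sum_pos' (fun l _ => mul_nonneg (hpow _ _ _) (hpow _ _ _))
      ⟨j, Finset.mem_univ j, mul_pos h1 h2⟩
  have hret : ∀ i, ∃ n₀, ∀ n ≥ n₀, 0 < (p ^ n) i i := by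
    intro i
    set S : Set ℕ := {n | 0 < n ∧ 0 < (p ^ n) i i} with hS
    have hgcd : Nat.setGcd S = 1 := haper i _ fun n hn hpn => Nat.setGcd_dvd_of_mem ⟨hn, hpn⟩
    obtain ⟨n₀, hn₀⟩ := Nat.exists_mem_closure_of_ge S
    refine ⟨n₀, fun n hn => ?_⟩
    refine AddSubmonoid.closure_induction (motive := fun n _ => 0 < (p ^ n) i i) (fun n hn => hn.2)
      (by simp) (fun a b _ _ ha hb => hmul ha hb) (hn₀ n hn (by simp [hgcd]))
  choose n₀ hn₀ using hret
  choose k hk hkpos using (Matrix.isIrreducible_iff_exists_pow_pos hnn).1 hirr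
  refine ⟨hnn, (∑ i, n₀ i) + (∑ i, ∑ j, k i j) + 1, by omega, fun i j => ?_⟩
  have h1 : n₀ i ≤ ∑ i, n₀ i := Finset.single_le_sum (fun _ _ => Nat.zero_le _) (Finset.mem_univ i)
  have h2 : k i j ≤ ∑ i, ∑ j, k i j :=
    (Finset.single_le_sum (f := fun j => k i j) (fun _ _ => Nat.zero_le _) (Finset.mem_univ j)).trans
      (Finset.single_le_sum (f := fun i => ∑ j, k i j) (fun _ _ => Nat.zero_le _) (Finset.mem_univ i))
  obtain ⟨d, hd⟩ := Nat.exists_eq_add_of_le h2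
  -- The initial loop at i is padded so that all pairs i, j get the same total length.
  have := hmul (hn₀ i ((∑ i, n₀ i) + d + 1) (by omega)) (hkpos i j)
  rwa [show (∑ i, n₀ i) + d + 1 + k i j = (∑ i, n₀ i) + (∑ i, ∑ j, k i j) + 1 by omega] at this

variable {K : ℕ} {p : Matrix (Fin K) (Fin K) ℝ}

theorem powMatrix_apply (p : Matrix (Fin K) (Fin K) ℝ) (θ : ℝ) (i j : Fin K) :
    powMatrix p θ i j = if p i j = 0 then 0 else p i j ^ θ := rfl

theorem powMatrix_nonneg (hp : ∀ i j, 0 ≤ p i j) (θ : ℝ) (i j : Fin K) : 0 ≤ powMatrix p θ i j := by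
  rw [powMatrix_apply]
  split_ifs
  exacts [le_rfl, Real.rpow_nonneg (hp i j) θ]

theorem powMatrix_pos (θ : ℝ) {i j : Fin K} (h : 0 < p i j) :
    0 < powMatrix p θ i j := by
  rw [powMatrix_apply, if_neg h.ne']
  exact Real.rpow_pos_of_pos h θ

/-- Which entries of a matrix power are positive depends only on the zero pattern, which A(θ) shares
with p. -/
theorem powMatrix_isPrimitive (hp : p.IsPrimitive) (θ : ℝ) : (powMatrix p θ).IsPrimitive := by
  have hnn := hp.nonneg
  obtain ⟨N, hN, hpos⟩ := hp.exists_pos_pow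
  refine ⟨powMatrix_nonneg hnn θ, N, hN, ?_⟩
  have key : ∀ n i j, 0 < (p ^ n) i j → 0 < (powMatrix p θ ^ n) i j := by
    intro n
    induction n with
    | zero => intro i j h; simpa using h
    | succ n ih =>
      intro i j h
      rw [pow_succ, Matrix.mul_apply] at h ⊢
      obtain ⟨k, -, hk⟩ := Finset.exists_lt_of_sum_lt (s := Finset.univ) (f := fun _ : Fin K => (0 : ℝ))
        (by simpa using h)
      have h1 : 0 < (p ^ n) i k :=
        pos_of_mul_pos_left hk (hnn k j)
      have h2 : 0 < p k j := pos_of_mul_pos_right hk h1.le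
      exact Finset.sum_pos' (fun l _ => mul_nonneg
        (Matrix.pow_apply_nonneg (powMatrix_nonneg hnn θ) n i l) (powMatrix_nonneg hnn θ l j))
        ⟨k, Finset.mem_univ k, mul_pos (ih i k h1) (powMatrix_pos θ h2)⟩
  exact fun i j => key N i j (hpos i j)

theorem powMatrix_differentiable (hp : ∀ i j, 0 ≤ p i j) (i j : Fin K) :
    Differentiable ℝ fun θ => powMatrix p θ i j := by
  simp only [powMatrix_apply]
  by_cases h : p i j = 0
  · simp [h]
  · have hpos : 0 < p i j := (hp i j).lt_of_ne' h
    simp only [if_neg h, Real.rpow_def_of_pos hpos]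
    fun_prop

variable {x : ℝ → Fin K → ℝ} {ρ : ℝ → ℝ}

/-- The Perron root of `powMatrix p θ` is log-convex in `θ`. -/
theorem convexOn_log_perron_root [NeZero K] (hp : p.IsPrimitive) (hx : ∀ θ, x θ ∈ stdSimplex ℝ (Fin K))
    (h : ∀ θ, (powMatrix p θ).mulVec (x θ) = ρ θ • x θ) :
    ConvexOn ℝ Set.univ fun θ => Real.log (ρ θ) := by
  have hnn := hp.nonneg
  have hρ : ∀ θ, 0 < ρ θ := fun θ => ((powMatrix_isPrimitive hp θ).eigenvector_pos (hx θ) (h θ)).1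
  have hxp : ∀ θ i, 0 < x θ i := fun θ =>
    ((powMatrix_isPrimitive hp θ).eigenvector_pos (hx θ) (h θ)).2
  refine ⟨convex_univ, fun s _ t _ a b ha hb hab => ?_⟩
  simp only [smul_eq_mul]
  have hle : ρ (a * s + b * t) ≤ ρ s ^ a * ρ t ^ b := by
    -- Hölder's inequality in disguise: the test vector is the geometric mean of the two Perron
    -- vectors, and weighted AM–GM is applied to terms normalised to have row sums 1.
    refine (powMatrix_isPrimitive hp _).eigenvalue_le (hx _) (h _)
      (w := fun i => x s i ^ a * x t i ^ b)
      (fun i => mul_pos (Real.rpow_pos_of_pos (hxp s i) a) (Real.rpow_pos_of_pos (hxp t i) b))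
      fun i => ?_
    have hrow : ∀ θ, ∑ j, powMatrix p θ i j * x θ j / (ρ θ * x θ i) = 1 := by
      intro θ
      rw [← Finset.sum_div, div_eq_one_iff_eq (mul_pos (hρ θ) (hxp θ i)).ne']
      exact congrFun (h θ) i
    have hD : 0 < (ρ s ^ a * ρ t ^ b) * (x s i ^ a * x t i ^ b) :=
      mul_pos (mul_pos (Real.rpow_pos_of_pos (hρ s) a) (Real.rpow_pos_of_pos (hρ t) b))
        (mul_pos (Real.rpow_pos_of_pos (hxp s i) a) (Real.rpow_pos_of_pos (hxp t i) b))
    rw [← div_le_one hD, Finset.sum_div]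
    calc ∑ j, powMatrix p (a * s + b * t) i j * (x s j ^ a * x t j ^ b) /
          ((ρ s ^ a * ρ t ^ b) * (x s i ^ a * x t i ^ b))
        ≤ ∑ j, (a * (powMatrix p s i j * x s j / (ρ s * x s i)) +
            b * (powMatrix p t i j * x t j / (ρ t * x t i))) := by
          refine Finset.sum_le_sum fun j _ => ?_
          by_cases hij : p i j = 0
          · simp [powMatrix_apply, hij]
          have hpos : 0 < p i j := (hnn i j).lt_of_ne' hij
          refine le_trans (le_of_eq ?_) (Real.geom_mean_le_arith_mean2_weighted ha hb
            (div_nonneg (mul_nonneg (powMatrix_nonneg hnn s i j) (hxp s j).le)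
              (mul_pos (hρ s) (hxp s i)).le)
            (div_nonneg (mul_nonneg (powMatrix_nonneg hnn t i j) (hxp t j).le)
              (mul_pos (hρ t) (hxp t i)).le) hab)
          simp only [powMatrix_apply, if_neg hij]
          rw [Real.div_rpow (by have := hxp s j; positivity) (mul_pos (hρ s) (hxp s i)).le,
            Real.div_rpow (by have := hxp t j; positivity) (mul_pos (hρ t) (hxp t i)).le,
            Real.mul_rpow (by positivity) (hxp s j).le, Real.mul_rpow (by positivity) (hxp t j).le,
            Real.mul_rpow (hρ s).le (hxp s i).le, Real.mul_rpow (hρ t).le (hxp t i).le,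
            ← Real.rpow_mul hpos.le, ← Real.rpow_mul hpos.le, Real.rpow_add hpos,
            mul_comm a s, mul_comm b t, div_mul_div_comm]
          congr 1 <;> ring
      _ = 1 := by
          rw [Finset.sum_add_distrib, ← Finset.mul_sum, ← Finset.mul_sum, hrow, hrow, mul_one, mul_one,
            hab]
  calc Real.log (ρ (a * s + b * t)) ≤ Real.log (ρ s ^ a * ρ t ^ b) := Real.log_le_log (hρ _) hle
    _ = a * Real.log (ρ s) + b * Real.log (ρ t) := by
      rw [Real.log_mul (Real.rpow_pos_of_pos (hρ s) a).ne' (Real.rpow_pos_of_pos (hρ t) b).ne',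
        Real.log_rpow (hρ s), Real.log_rpow (hρ t)]

end PowMatrix

/-! ### The max-times eigenvector -/

section MaxTimes

variable {K : ℕ} {p : Matrix (Fin K) (Fin K) ℝ}

/-- A normalised approximate max-times eigenvector, obtained from the Perron vector of
`powMatrix p (n + 1)`. -/
theorem exists_approx_maxTimes_eigenvector [NeZero K] (hp : p.IsPrimitive) (n : ℕ) :
    ∃ (l : ℝ) (h : Fin K → ℝ), 0 ≤ l ∧ (∀ i, h i ∈ Set.Icc (0 : ℝ) 1) ∧ (∃ i, h i = 1) ∧
      (∀ i j, p i j * h j ≤ l * h i) ∧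
      ∀ i, ∃ j, l * h i ≤ (K : ℝ) ^ (((n + 1 : ℕ) : ℝ)⁻¹) * (p i j * h j) := by
  have hnn := hp.nonneg
  have hP := powMatrix_isPrimitive hp ((n + 1 : ℕ) : ℝ)
  obtain ⟨x, hx, r, hr⟩ := hP.exists_eigenvector
  obtain ⟨hr0, hxp⟩ := hP.eigenvector_pos hx hr
  have hn : n + 1 ≠ 0 := n.succ_ne_zero
  have hentry : ∀ i j, powMatrix p ((n + 1 : ℕ) : ℝ) i j = p i j ^ (n + 1) := by
    intro i j
    rw [powMatrix_apply, Real.rpow_natCast]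
    split_ifs with h
    · rw [h, zero_pow hn]
    · rfl
  obtain ⟨i₀, hi₀⟩ := Finite.exists_max x
  set M := x i₀ with hM
  have hM0 : 0 < M := hxp i₀
  set c : ℝ := ((n + 1 : ℕ) : ℝ)⁻¹ with hc
  have hc0 : 0 ≤ c := by positivity
  have hroot : ∀ {a : ℝ}, 0 ≤ a → (a ^ c) ^ (n + 1) = a := fun ha => Real.rpow_inv_natCast_pow ha hn
  have hxM : ∀ i, 0 ≤ x i / M := fun i => div_nonneg (hxp i).le hM0.le
  have hrow : ∀ i, ∑ j, p i j ^ (n + 1) * x j = r * x i := by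
    intro i
    have := congrFun hr i
    simp only [Matrix.mulVec, dotProduct, hentry, Pi.smul_apply, smul_eq_mul] at this
    exact this
  -- Taking (n+1)-th roots: a sum of K nonnegative terms lies between its largest term and K times
  -- that term.
  refine ⟨r ^ c, fun i => (x i / M) ^ c, Real.rpow_nonneg hr0.le c, fun i => ⟨Real.rpow_nonneg (hxM i) c,
    Real.rpow_le_one (hxM i) ((div_le_one hM0).2 (hi₀ i)) hc0⟩, ⟨i₀, by simp [← hM, div_self hM0.ne']⟩,
    fun i j => ?_, fun i => ?_⟩
  · refine le_of_pow_le_pow_left₀ hn (mul_nonneg (Real.rpow_nonneg hr0.le c)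
      (Real.rpow_nonneg (hxM i) c)) ?_
    rw [mul_pow, mul_pow, hroot (hxM j), hroot (hxM i), hroot hr0.le, mul_div_assoc', mul_div_assoc',
      ← hrow i]
    gcongr
    exact Finset.single_le_sum (f := fun j => p i j ^ (n + 1) * x j)
      (fun k _ => mul_nonneg (pow_nonneg (hnn i k) _) (hxp k).le) (Finset.mem_univ j)
  · obtain ⟨j, hj⟩ := Finite.exists_max fun j => p i j ^ (n + 1) * x j
    refine ⟨j, ?_⟩
    refine le_of_pow_le_pow_left₀ hn (mul_nonneg (Real.rpow_nonneg (Nat.cast_nonneg K) c)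
      (mul_nonneg (hnn i j) (Real.rpow_nonneg (hxM j) c))) ?_
    rw [mul_pow, mul_pow, mul_pow, hroot (hxM j), hroot (hxM i), hroot hr0.le,
      hroot (Nat.cast_nonneg K), mul_div_assoc', mul_div_assoc', mul_div_assoc', ← hrow i]
    gcongr
    refine (Finset.sum_le_card_nsmul _ _ _ fun k _ => hj k).trans (le_of_eq ?_)
    simp

/-- A subsequential limit of the approximate eigenvectors, whose error factor K^(1/(n+1)) tends to
1. Primitivity makes the limit strictly positive. -/
theorem exists_maxTimes_eigenvector [NeZero K] (hp : p.IsPrimitive) :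
    ∃ (l : ℝ) (h : Fin K → ℝ), 0 < l ∧ (∀ i, 0 < h i) ∧ (∀ i j, p i j * h j ≤ l * h i) ∧
      ∀ i, ∃ j, p i j * h j = l * h i := by
  have hnn := hp.nonneg
  choose L H hL hH hH1 hle hge using exists_approx_maxTimes_eigenvector hp
  have hne : (Finset.univ : Finset (Fin K)).Nonempty := Finset.univ_nonempty
  set T : ℝ := ∑ i, ∑ j, p i j with hT
  have hpT : ∀ i j, p i j ≤ T := fun i j =>
    (Finset.single_le_sum (f := fun j => p i j) (fun j _ => hnn i j) (Finset.mem_univ j)).trans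
      (Finset.single_le_sum (f := fun i => ∑ j, p i j)
        (fun i _ => Finset.sum_nonneg fun j _ => hnn i j) (Finset.mem_univ i))
  have hK1 : (1 : ℝ) ≤ K := by exact_mod_cast NeZero.one_le
  have hKpow : ∀ n : ℕ, (K : ℝ) ^ (((n + 1 : ℕ) : ℝ)⁻¹) ≤ K := fun n => by
    refine Real.rpow_le_self_of_one_le hK1 (inv_le_one_of_one_le₀ ?_)
    exact_mod_cast Nat.succ_pos n
  have hLT : ∀ n, L n ≤ K * T := by
    intro n
    obtain ⟨i, hi⟩ := hH1 n
    obtain ⟨j, hj⟩ := hge n i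
    rw [hi, mul_one] at hj
    refine hj.trans ?_
    have h1 : p i j * H n j ≤ T :=
      (mul_le_of_le_one_right (hnn i j) (hH n j).2).trans (hpT i j)
    exact mul_le_mul (hKpow n) h1 (mul_nonneg (hnn i j) (hH n j).1) (by linarith)
  have hcomp : IsCompact (Set.Icc (0 : ℝ) (K * T) ×ˢ Set.pi Set.univ fun _ : Fin K => Set.Icc (0 : ℝ) 1) :=
    isCompact_Icc.prod (isCompact_univ_pi fun _ => isCompact_Icc)
  obtain ⟨⟨l, h⟩, hmem, φ, hφ, hlim⟩ := hcomp.tendsto_subseq (x := fun n => (L n, H n))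
    fun n => ⟨⟨hL n, hLT n⟩, fun i _ => hH n i⟩
  have hl : Tendsto (fun n => L (φ n)) atTop (𝓝 l) :=
    (continuous_fst.tendsto (l, h)).comp hlim
  have hh : ∀ i, Tendsto (fun n => H (φ n) i) atTop (𝓝 (h i)) := fun i =>
    (((continuous_apply i).comp continuous_snd).tendsto (l, h)).comp hlim
  have hl0 : 0 ≤ l := hmem.1.1
  have hh0 : ∀ i, 0 ≤ h i := fun i => (hmem.2 i (Set.mem_univ i)).1
  have hle' : ∀ i j, p i j * h j ≤ l * h i := fun i j =>
    le_of_tendsto_of_tendsto' ((hh j).const_mul (p i j)) (hl.mul (hh i)) fun n => hle (φ n) i j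
  -- A finite maximum is continuous, so tightness survives the limit without tracking the maximising
  -- index.
  have hsup : ∀ f : Fin K → ℝ, Tendsto (fun n => Finset.univ.sup' hne fun j => f j * H (φ n) j) atTop
      (𝓝 (Finset.univ.sup' hne fun j => f j * h j)) := fun f =>
    Tendsto.finset_sup'_nhds_apply hne fun j _ => (hh j).const_mul (f j)
  have hone : ∃ i, 0 < h i := by
    obtain ⟨i, -, hi⟩ := Finset.exists_mem_eq_sup' hne fun j => 1 * h j
    refine ⟨i, ?_⟩
    have h1 : (1 : ℝ) ≤ Finset.univ.sup' hne fun j => 1 * h j := by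
      refine ge_of_tendsto' (hsup fun _ => 1) fun n => ?_
      obtain ⟨i, hi⟩ := hH1 (φ n)
      calc (1 : ℝ) = 1 * H (φ n) i := by rw [hi, one_mul]
        _ ≤ _ := Finset.le_sup' (fun j => 1 * H (φ n) j) (Finset.mem_univ i)
    rw [hi, one_mul] at h1
    linarith
  have htight : ∀ i, ∃ j, p i j * h j = l * h i := by
    intro i
    obtain ⟨j, -, hj⟩ := Finset.exists_mem_eq_sup' hne fun j => p i j * h j
    refine ⟨j, (hle' i j).antisymm ?_⟩
    rw [← hj, ← one_mul (Finset.univ.sup' hne fun j => p i j * h j)]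
    have hK : Tendsto (fun n => (K : ℝ) ^ (((φ n + 1 : ℕ) : ℝ)⁻¹)) atTop (𝓝 1) := by
      have h0 : Tendsto (fun n => (((φ n + 1 : ℕ) : ℝ)⁻¹)) atTop (𝓝 0) :=
        tendsto_inv_atTop_zero.comp (tendsto_natCast_atTop_atTop.comp
          ((tendsto_add_atTop_nat 1).comp hφ.tendsto_atTop))
      have := (tendsto_const_nhds (x := (K : ℝ))).rpow h0 (Or.inl (by positivity))
      rwa [Real.rpow_zero] at this
    refine le_of_tendsto_of_tendsto' (hl.mul (hh i)) (hK.mul (hsup (p i))) fun n => ?_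
    obtain ⟨k, hk⟩ := hge (φ n) i
    refine hk.trans (mul_le_mul_of_nonneg_left ?_ (Real.rpow_nonneg (by positivity) _))
    exact Finset.le_sup' (fun j => p i j * H (φ n) j) (Finset.mem_univ k)
  obtain ⟨i₀, hi₀⟩ := hone
  obtain ⟨N, hN, hpos⟩ := hp.exists_pos_pow
  -- Positivity of h travels backwards along paths of positive probability; the factor l^n also
  -- yields l ≠ 0 at n = N > 0.
  have hpath : ∀ n i j, 0 < (p ^ n) i j → 0 < h j → 0 < l ^ n * h i := by
    intro n
    induction n with
    | zero =>
      intro i j hij hj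
      by_cases e : i = j
      · subst e; simpa using hj
      · simp [e] at hij
    | succ n ih =>
      intro i j hij hj
      rw [pow_succ, Matrix.mul_apply] at hij
      obtain ⟨k, -, hk⟩ := Finset.exists_lt_of_sum_lt (s := Finset.univ) (f := fun _ : Fin K => (0 : ℝ))
        (by simpa using hij)
      have h1 : 0 < (p ^ n) i k := pos_of_mul_pos_left hk (hnn k j)
      have h2 : 0 < p k j := pos_of_mul_pos_right hk h1.le
      have h3 : 0 < l * h k := (mul_pos h2 hj).trans_le (hle' k j)
      have h4 : 0 < h k := pos_of_mul_pos_right h3 hl0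
      have h5 : 0 < l := pos_of_mul_pos_left h3 h4.le
      have h6 := pos_of_mul_pos_right (ih i k h1 h4) (pow_nonneg hl0 n)
      positivity
  have hall : ∀ i, 0 < l ^ N * h i := fun i => hpath N i i₀ (hpos i i₀) hi₀
  refine ⟨l, h, ?_, fun i => pos_of_mul_pos_right (hall i) (pow_nonneg hl0 N), hle', htight⟩
  refine hl0.lt_of_ne ?_
  rintro rfl
  simpa [hN.ne'] using hall i₀

/-- The max-times eigenvalue of a primitive stochastic matrix of size at least two is less
than one. -/
theorem maxTimes_eigenvalue_lt_one (hK : 2 ≤ K) (hp : p.IsPrimitive)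
    (hs : p ∈ Matrix.rowStochastic ℝ (Fin K)) {l : ℝ} {h : Fin K → ℝ} (hh : ∀ i, 0 < h i)
    (ht : ∀ i, ∃ j, p i j * h j = l * h i) : l < 1 := by
  by_contra! hl
  have : Nonempty (Fin K) := ⟨⟨0, by omega⟩⟩
  have hone : ∀ n i j, (p ^ n) i j ≤ 1 := fun n i j =>
    Matrix.le_one_of_mem_rowStochastic (pow_mem hs n)
  obtain ⟨i₀, hi₀⟩ := Finite.exists_max h
  -- If l ≥ 1, a tight transition out of a maximiser of h has probability 1 and leads to another
  -- maximiser. Iterating gives an entry 1 in a row of p^N, whose K ≥ 2 entries are all positive and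
  -- sum to 1.
  have hstep : ∀ i, h i = h i₀ → ∃ j, h j = h i₀ ∧ p i j = 1 := by
    intro i hi
    obtain ⟨j, hj⟩ := ht i
    have hp1 : p i j ≤ 1 := by simpa using hone 1 i j
    have hnn := hp.nonneg i j
    have hj0 := hi₀ j
    have hpos := hh i₀
    rw [hi] at hj
    have h1 : h i₀ ≤ p i j * h j := by rw [hj]; nlinarith
    have h2 : h j = h i₀ := by nlinarith [hh j]
    refine ⟨j, h2, ?_⟩
    rw [h2] at h1
    nlinarith
  have hdet : ∀ n, ∃ j, h j = h i₀ ∧ (p ^ n) i₀ j = 1 := by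
    intro n
    induction n with
    | zero => exact ⟨i₀, rfl, by simp⟩
    | succ n ih =>
      obtain ⟨j, hj, hpj⟩ := ih
      obtain ⟨k, hk, hpk⟩ := hstep j hj
      refine ⟨k, hk, (hone _ _ _).antisymm ?_⟩
      rw [pow_succ, Matrix.mul_apply]
      calc (1 : ℝ) = (p ^ n) i₀ j * p j k := by rw [hpj, hpk, one_mul]
        _ ≤ _ := Finset.single_le_sum (f := fun j => (p ^ n) i₀ j * p j k)
          (fun m _ => mul_nonneg (Matrix.pow_apply_nonneg hp.nonneg n i₀ m) (hp.nonneg m k))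
          (Finset.mem_univ j)
  obtain ⟨N, hN, hpos⟩ := hp.exists_pos_pow
  obtain ⟨j, -, hj⟩ := hdet N
  have : Nontrivial (Fin K) := Fin.nontrivial_iff_two_le.2 hK
  obtain ⟨k, hkj⟩ := exists_ne j
  have hsum := Matrix.sum_row_of_mem_rowStochastic (pow_mem hs N) i₀
  have h2 : (p ^ N) i₀ j + (p ^ N) i₀ k ≤ ∑ j, (p ^ N) i₀ j := by
    rw [← Finset.sum_pair hkj.symm]
    exact Finset.sum_le_sum_of_subset_of_nonneg (Finset.subset_univ _) fun m _ _ => (hpos i₀ m).le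
  have h3 := hpos i₀ k
  linarith

variable {l : ℝ} {h : Fin K → ℝ}

/-- Collatz–Wielandt with test vector h^θ: each of the K terms of a row is at most l^θ h_i^θ. In the
lower bound below, the tight term alone suffices. -/
theorem perron_root_le [NeZero K] (hp : p.IsPrimitive) (hl : 0 < l) (hh : ∀ i, 0 < h i)
    (hle : ∀ i j, p i j * h j ≤ l * h i) {θ r : ℝ} (hθ : 0 ≤ θ) {x : Fin K → ℝ}
    (hx : x ∈ stdSimplex ℝ (Fin K)) (hr : (powMatrix p θ).mulVec x = r • x) : r ≤ K * l ^ θ := by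
  refine (powMatrix_isPrimitive hp θ).eigenvalue_le hx hr (w := fun i => h i ^ θ)
    (fun i => Real.rpow_pos_of_pos (hh i) θ) fun i => ?_
  have : ∀ j ∈ Finset.univ, powMatrix p θ i j * h j ^ θ ≤ l ^ θ * h i ^ θ := by
    intro j _
    rw [powMatrix_apply]
    split_ifs with h0
    · rw [zero_mul]
      exact mul_nonneg (Real.rpow_nonneg hl.le θ) (Real.rpow_nonneg (hh i).le θ)
    · rw [← Real.mul_rpow (hp.nonneg i j) (hh j).le, ← Real.mul_rpow hl.le (hh i).le]
      exact Real.rpow_le_rpow (mul_nonneg (hp.nonneg i j) (hh j).le) (hle i j) hθ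
  refine (Finset.sum_le_card_nsmul _ _ _ this).trans (le_of_eq ?_)
  simp [mul_assoc]

theorem le_perron_root [NeZero K] (hp : p.IsPrimitive) (hl : 0 < l) (hh : ∀ i, 0 < h i)
    (ht : ∀ i, ∃ j, p i j * h j = l * h i) {θ r : ℝ} {x : Fin K → ℝ}
    (hx : x ∈ stdSimplex ℝ (Fin K)) (hr : (powMatrix p θ).mulVec x = r • x) : l ^ θ ≤ r := by
  refine (powMatrix_isPrimitive hp θ).le_eigenvalue hx hr (w := fun i => h i ^ θ)
    (fun i => Real.rpow_pos_of_pos (hh i) θ) fun i => ?_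
  obtain ⟨j, hj⟩ := ht i
  have hpos : 0 < p i j := pos_of_mul_pos_left (by rw [hj]; exact mul_pos hl (hh i)) (hh j).le
  refine le_trans (le_of_eq ?_) (Finset.single_le_sum (f := fun j => powMatrix p θ i j * h j ^ θ)
    (fun k _ => mul_nonneg (powMatrix_nonneg hp.nonneg θ i k) (Real.rpow_nonneg (hh k).le θ))
    (Finset.mem_univ j))
  rw [powMatrix_apply, if_neg hpos.ne', ← Real.mul_rpow hl.le (hh i).le, ← hj,
    Real.mul_rpow hpos.le (hh j).le]

/-- A differentiable convex function within bounded distance of a linear function on `[0, ∞)` has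
derivative tending to the slope. -/
theorem tendsto_deriv_of_convexOn {f : ℝ → ℝ} (hf : ConvexOn ℝ Set.univ f) (hd : Differentiable ℝ f)
    {a c : ℝ} (hlow : ∀ θ, 0 ≤ θ → θ * a ≤ f θ) (hup : ∀ θ, 0 ≤ θ → f θ ≤ θ * a + c) :
    Tendsto (deriv f) atTop (𝓝 a) := by
  have hinv : ∀ b : ℝ, Tendsto (fun θ : ℝ => a + b / θ) atTop (𝓝 a) := fun b => by
    simpa using (tendsto_const_nhds (x := a)).add (tendsto_const_nhds.div_atTop tendsto_id : Tendsto (fun θ : ℝ => b / θ) atTop (𝓝 0))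
  refine tendsto_of_tendsto_of_tendsto_of_le_of_le' (hinv (-(2 * c))) (hinv c) ?_ ?_
  · filter_upwards [eventually_gt_atTop (0 : ℝ)] with θ hθ
    -- The derivative at θ lies between the secant slopes over [θ/2, θ] and [θ, 2θ]. These lengths
    -- grow with θ, so the bounded error contributes only O(1/θ).
    have := hf.slope_le_of_hasDerivAt (x := θ / 2) (y := θ) (Set.mem_univ _) (Set.mem_univ _)
      (by linarith) (hd θ).hasDerivAt
    refine le_trans ?_ this
    rw [slope_def_field, le_div_iff₀ (by linarith)]
    have h1 := hlow θ hθ.le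
    have h2 := hup (θ / 2) (by linarith)
    have h3 : (a + -(2 * c) / θ) * (θ - θ / 2) = a * (θ / 2) - c := by field_simp; ring
    rw [h3]
    linarith
  · filter_upwards [eventually_gt_atTop (0 : ℝ)] with θ hθ
    have := hf.le_slope_of_hasDerivAt (x := θ) (y := 2 * θ) (Set.mem_univ _) (Set.mem_univ _)
      (by linarith) (hd θ).hasDerivAt
    refine this.trans ?_
    rw [slope_def_field, div_le_iff₀ (by linarith)]
    have h1 := hlow θ hθ.le
    have h2 := hup (2 * θ) (by linarith)
    have h3 : (a + c / θ) * (2 * θ - θ) = a * θ + c := by field_simp; ring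
    rw [h3]
    linarith

theorem tendsto_perron_root_div_deriv [NeZero K] (hp : p.IsPrimitive) (hl : 0 < l) (hl1 : l < 1)
    (hh : ∀ i, 0 < h i)
    (hle : ∀ i j, p i j * h j ≤ l * h i) (ht : ∀ i, ∃ j, p i j * h j = l * h i)
    {x : ℝ → Fin K → ℝ} {ρ : ℝ → ℝ} (hx : ∀ θ, x θ ∈ stdSimplex ℝ (Fin K))
    (hr : ∀ θ, (powMatrix p θ).mulVec (x θ) = ρ θ • x θ) :
    Tendsto (fun θ => ρ θ / (-deriv ρ θ)) atTop (𝓝 (-Real.log l)⁻¹) := by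
  have hρ : ∀ θ, 0 < ρ θ := fun θ => ((powMatrix_isPrimitive hp θ).eigenvector_pos (hx θ) (hr θ)).1
  have hd : Differentiable ℝ ρ := differentiable_perron_root (powMatrix_isPrimitive hp)
    (powMatrix_differentiable hp.nonneg) hx hr
  have hK : (0 : ℝ) < K := by exact_mod_cast NeZero.pos K
  have hlim : Tendsto (deriv fun θ => Real.log (ρ θ)) atTop (𝓝 (Real.log l)) := by
    refine tendsto_deriv_of_convexOn (c := Real.log K) (convexOn_log_perron_root hp hx hr)
      (fun θ => (hd θ).log (hρ θ).ne') (fun θ _ => ?_) fun θ hθ => ?_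
    · rw [← Real.log_rpow hl]
      exact Real.log_le_log (Real.rpow_pos_of_pos hl θ) (le_perron_root hp hl hh ht (hx θ) (hr θ))
    · rw [← Real.log_rpow hl, add_comm, ← Real.log_mul hK.ne' (Real.rpow_pos_of_pos hl θ).ne']
      exact Real.log_le_log (hρ θ) (perron_root_le hp hl hh hle hθ (hx θ) (hr θ))
  have := hlim.neg.inv₀ (neg_ne_zero.2 (Real.log_neg hl hl1).ne)
  refine this.congr fun θ => ?_
  rw [deriv.log (hd θ) (hρ θ).ne', ← neg_div, inv_div]

end MaxTimes

/-! ### Probabilities of boxes -/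

section Boxes

variable {K : ℕ} {p : Matrix (Fin K) (Fin K) ℝ} {s : Fin K} {Ω : Type*} [MeasurableSpace Ω]
  {μ : Measure Ω} [IsProbabilityMeasure μ]

theorem IsMarkovChainFrom.measure_path {X : ℕ → Ω → Fin K} (hX : IsMarkovChainFrom μ p s X)
    (hp : ∀ i j, 0 ≤ p i j) {x : ℕ → Fin K} (hx : x 0 = s) (n : ℕ) :
    μ {ω | ∀ k ≤ n, X k ω = x k} = ENNReal.ofReal (∏ k ∈ Finset.range n, p (x k) (x (k + 1))) := by
  induction n with
  | zero =>
    have : {ω | ∀ k ≤ 0, X k ω = x k} =ᵐ[μ] Set.univ := by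
      filter_upwards [hX.initial] with ω hω
      refine propext ⟨fun _ => trivial, fun _ k hk => ?_⟩
      rw [Nat.le_zero.1 hk, hx, hω]
    rw [measure_congr this]
    simp
  | succ n ih =>
    rw [hX.step, ih, Finset.prod_range_succ,
      ENNReal.ofReal_mul (Finset.prod_nonneg fun k _ => hp _ _)]

theorem IsMarkovChainFrom.measureReal_box {X : ℕ → Ω → Fin K} (hX : IsMarkovChainFrom μ p s X)
    (hp : ∀ i j, 0 ≤ p i j) {x : ℕ → Fin K} (hx : x 0 = s) (n : ℕ) :
    μ.real {ω | ∀ k : Fin n, X (k + 1) ω = x (k + 1)} =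
      ∏ k ∈ Finset.range n, p (x k) (x (k + 1)) := by
  have : {ω | ∀ k : Fin n, X (k + 1) ω = x (k + 1)} =ᵐ[μ] {ω | ∀ k ≤ n, X k ω = x k} := by
    filter_upwards [hX.initial] with ω hω
    refine propext ⟨fun h k hk => ?_, fun h k => h _ k.2⟩
    cases k with
    | zero => rw [hω, hx]
    | succ k => exact h ⟨k, hk⟩
  rw [measureReal_congr this, measureReal_def, hX.measure_path hp hx,
    ENNReal.toReal_ofReal (Finset.prod_nonneg fun k _ => hp _ _)]

variable {l : ℝ} {h : Fin K → ℝ}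

theorem prod_mul_le_pow (hp : ∀ i j, 0 ≤ p i j) (hl : 0 ≤ l) (hle : ∀ i j, p i j * h j ≤ l * h i)
    (x : ℕ → Fin K) (n : ℕ) :
    (∏ k ∈ Finset.range n, p (x k) (x (k + 1))) * h (x n) ≤ l ^ n * h (x 0) := by
  induction n with
  | zero => simp
  | succ n ih =>
    rw [Finset.prod_range_succ, mul_assoc]
    calc _ ≤ (∏ k ∈ Finset.range n, p (x k) (x (k + 1))) * (l * h (x n)) :=
          mul_le_mul_of_nonneg_left (hle _ _) (Finset.prod_nonneg fun k _ => hp _ _)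
      _ = l * ((∏ k ∈ Finset.range n, p (x k) (x (k + 1))) * h (x n)) := by ring
      _ ≤ l * (l ^ n * h (x 0)) := mul_le_mul_of_nonneg_left ih hl
      _ = _ := by ring

theorem prod_mul_eq_pow {x : ℕ → Fin K} (hx : ∀ k, p (x k) (x (k + 1)) * h (x (k + 1)) = l * h (x k))
    (n : ℕ) : (∏ k ∈ Finset.range n, p (x k) (x (k + 1))) * h (x n) = l ^ n * h (x 0) := by
  induction n with
  | zero => simp
  | succ n ih =>
    rw [Finset.prod_range_succ, mul_assoc, hx, mul_left_comm, ih]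
    ring

/-- The box probabilities at generation `n` are at most of order `l ^ n`, and one is of that
order. -/
theorem exists_box_bounds (hp : ∀ i j, 0 ≤ p i j) (hl : 0 < l) (hh : ∀ i, 0 < h i)
    (hle : ∀ i j, p i j * h j ≤ l * h i) (ht : ∀ i, ∃ j, p i j * h j = l * h i) (s : Fin K) :
    ∃ c > 0, ∀ (n : ℕ),
      (∀ (X : ℕ → Ω → Fin K), IsMarkovChainFrom μ p s X → ∀ u : Fin n → Fin K,
        μ.real {ω | ∀ k : Fin n, X (k + 1) ω = u k} ≤ c * l ^ n) ∧
      ∃ u : Fin n → Fin K, ∀ (X : ℕ → Ω → Fin K), IsMarkovChainFrom μ p s X →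
        c⁻¹ * l ^ n ≤ μ.real {ω | ∀ k : Fin n, X (k + 1) ω = u k} := by
  have : Nonempty (Fin K) := ⟨s⟩
  obtain ⟨i₁, hi₁⟩ := Finite.exists_max h
  obtain ⟨i₂, hi₂⟩ := Finite.exists_min h
  have hratio : ∀ i j, h i ≤ h i₁ / h i₂ * h j := by
    intro i j
    rw [div_mul_eq_mul_div, le_div_iff₀ (hh i₂)]
    exact mul_le_mul (hi₁ i) (hi₂ j) (hh i₂).le (hh i₁).le
  -- After telescoping only h(s)/h(x_n) or its inverse remains, controlled by max h / min h.
  refine ⟨h i₁ / h i₂, div_pos (hh i₁) (hh i₂), fun n => ⟨fun X hX u => ?_, ?_⟩⟩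
  -- The word u is shifted by one to make room for the starting state s; values beyond generation n
  -- are irrelevant.
  · set x : ℕ → Fin K := fun k =>
      if hk : k = 0 then s else if hk' : k - 1 < n then u ⟨k - 1, hk'⟩ else s with hx
    have hx0 : x 0 = s := by simp [hx]
    have hxu : ∀ k : Fin n, x (k + 1) = u k := fun k => by simp [hx]
    have hset : {ω | ∀ k : Fin n, X (k + 1) ω = u k} = {ω | ∀ k : Fin n, X (k + 1) ω = x (k + 1)} := by
      simp only [hxu]
    rw [hset, hX.measureReal_box hp hx0]
    refine le_of_mul_le_mul_right ((prod_mul_le_pow hp hl.le hle x n).trans ?_) (hh (x n))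
    rw [mul_right_comm, mul_comm]
    exact mul_le_mul_of_nonneg_right (hratio _ _) (pow_nonneg hl.le n)
  -- The heavy box follows, from s, a tight transition at every step.
  · choose t htt using ht
    set x : ℕ → Fin K := fun k => t^[k] s with hx
    have hstep : ∀ k, p (x k) (x (k + 1)) * h (x (k + 1)) = l * h (x k) := fun k => by
      simp only [hx, Function.iterate_succ_apply']
      exact htt _
    refine ⟨fun k => x (k + 1), fun X hX => ?_⟩
    rw [hX.measureReal_box hp (x := x) rfl]
    refine le_of_mul_le_mul_right (le_trans ?_ (prod_mul_eq_pow hstep n).ge) (hh (x n))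
    rw [mul_right_comm, mul_comm]
    refine mul_le_mul_of_nonneg_left ?_ (pow_nonneg hl.le n)
    rw [inv_mul_le_iff₀ (div_pos (hh i₁) (hh i₂))]
    exact hratio _ _

end Boxes

/-! ### Chernoff bounds for the number of occurring events -/

section Chernoff

variable {Ω : Type*} [MeasurableSpace Ω] {μ : Measure Ω} [IsProbabilityMeasure μ]

theorem mgf_indicator {E : Set Ω} (hE : MeasurableSet E) (t : ℝ) :
    mgf (E.indicator fun _ => (1 : ℝ)) μ t = 1 + (Real.exp t - 1) * μ.real E := by
  have : (fun ω => Real.exp (t * E.indicator (fun _ => (1 : ℝ)) ω)) =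
      fun ω => 1 + E.indicator (fun _ => Real.exp t - 1) ω := by
    funext ω
    by_cases hω : ω ∈ E <;> simp [hω]
  rw [mgf, this, integral_add (integrable_const _) ((integrable_const _).indicator hE),
    integral_indicator_const _ hE]
  simp [mul_comm]

theorem mgf_sum_indicator_le {E : ℕ → Set Ω} (hE : ∀ b, MeasurableSet (E b))
    (hind : iIndepFun (fun b => (E b).indicator fun _ => (1 : ℝ)) μ) (m : ℕ) {t q : ℝ}
    (hq : ∀ b, (Real.exp t - 1) * μ.real (E b) ≤ q) :
    mgf (∑ b ∈ Finset.range m, (E b).indicator fun _ => (1 : ℝ)) μ t ≤ Real.exp (m * q) := by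
  rw [hind.mgf_sum (fun b => measurable_const.indicator (hE b)), Real.exp_nat_mul]
  refine (Finset.prod_le_prod (fun b _ => mgf_nonneg) (g := fun _ => Real.exp q) fun b _ => ?_).trans
    (by simp)
  rw [mgf_indicator (hE b)]
  linarith [hq b, Real.add_one_le_exp q]

theorem integrable_exp_sum_indicator {E : ℕ → Set Ω} (hE : ∀ b, MeasurableSet (E b)) (m : ℕ) (t : ℝ) :
    Integrable (fun ω => Real.exp
      (t * (∑ b ∈ Finset.range m, (E b).indicator fun _ => (1 : ℝ)) ω)) μ := by
  have hmeas : Measurable (∑ b ∈ Finset.range m, (E b).indicator fun _ => (1 : ℝ)) := by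
    refine Finset.sum_induction _ Measurable (fun _ _ => Measurable.add) measurable_const fun b _ => ?_
    exact measurable_const.indicator (hE b)
  refine Integrable.of_bound (C := Real.exp (|t| * m))
    (Real.measurable_exp.comp (hmeas.const_mul t)).aestronglyMeasurable
    (Eventually.of_forall fun ω => ?_)
  rw [Real.norm_of_nonneg (Real.exp_nonneg _), Real.exp_le_exp, Finset.sum_apply]
  have h0 : 0 ≤ ∑ b ∈ Finset.range m, (E b).indicator (fun _ => (1 : ℝ)) ω :=
    Finset.sum_nonneg fun b _ => Set.indicator_nonneg (fun _ _ => zero_le_one) ω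
  have h1 : ∑ b ∈ Finset.range m, (E b).indicator (fun _ => (1 : ℝ)) ω ≤ m := by
    refine (Finset.sum_le_card_nsmul _ _ 1 fun b _ => ?_).trans (by simp)
    exact Set.indicator_apply_le' (fun _ => le_rfl) fun _ => zero_le_one
  exact mul_le_mul (le_abs_self t) h1 h0 (abs_nonneg t)

/-- Chernoff at t = 1, with e - 1 ≤ 2. The lower tail below uses t = -1, with 1/e - 1 ≤ -1/2. -/
theorem measure_sum_indicator_ge_le {E : ℕ → Set Ω} (hE : ∀ b, MeasurableSet (E b))
    (hind : iIndepFun (fun b => (E b).indicator fun _ => (1 : ℝ)) μ) (m : ℕ) {q : ℝ}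
    (hq : ∀ b, μ.real (E b) ≤ q) (a : ℝ) :
    μ.real {ω | a ≤ (∑ b ∈ Finset.range m, (E b).indicator fun _ => (1 : ℝ)) ω} ≤
      Real.exp (-a + 2 * (m * q)) := by
  refine (measure_ge_le_exp_mul_mgf a zero_le_one (integrable_exp_sum_indicator hE m 1)).trans ?_
  rw [Real.exp_add, neg_one_mul, show 2 * (m * q) = m * (2 * q) by ring]
  refine mul_le_mul_of_nonneg_left (mgf_sum_indicator_le hE hind m fun b => ?_) (Real.exp_nonneg _)
  refine mul_le_mul ?_ (hq b) measureReal_nonneg zero_le_two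
  linarith [Real.exp_one_lt_d9]

theorem measure_sum_indicator_le_le {E : ℕ → Set Ω} (hE : ∀ b, MeasurableSet (E b))
    (hind : iIndepFun (fun b => (E b).indicator fun _ => (1 : ℝ)) μ) (m : ℕ) {q : ℝ}
    (hq : ∀ b, q ≤ μ.real (E b)) (a : ℝ) :
    μ.real {ω | (∑ b ∈ Finset.range m, (E b).indicator fun _ => (1 : ℝ)) ω ≤ a} ≤
      Real.exp (a - m * q / 2) := by
  refine (measure_le_le_exp_mul_mgf a (by norm_num : (-1 : ℝ) ≤ 0)
    (integrable_exp_sum_indicator hE m (-1))).trans ?_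
  rw [sub_eq_add_neg, Real.exp_add, neg_neg, one_mul, show -(m * q / 2) = m * (-(q / 2)) by ring]
  refine mul_le_mul_of_nonneg_left (mgf_sum_indicator_le hE hind m fun b => ?_) (Real.exp_nonneg _)
  have h1 : Real.exp (-1) ≤ 1 / 2 := by
    rw [Real.exp_neg, one_div]
    exact inv_anti₀ zero_lt_two (by linarith [Real.add_one_le_exp (1 : ℝ)])
  have h2 := hq b
  have h3 : 0 ≤ μ.real (E b) := measureReal_nonneg
  nlinarith

/-- First Borel–Cantelli lemma for events whose probability is eventually at most
`exp (-2 log m)`. -/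
theorem ae_eventually_notMem_of_le_exp {S : ℕ → Set Ω}
    (hS : ∀ᶠ m : ℕ in atTop, μ.real (S m) ≤ Real.exp (-2 * Real.log m)) :
    ∀ᵐ ω ∂μ, ∀ᶠ m in atTop, ω ∉ S m := by
  have hsum : Summable fun m => μ.real (S m) := by
    refine Summable.of_norm_bounded_eventually_nat (g := fun m : ℕ => ((m : ℝ) ^ 2)⁻¹)
      (Real.summable_nat_pow_inv.2 one_lt_two) ?_
    filter_upwards [hS, eventually_gt_atTop 0] with m hm hm0
    rw [Real.norm_of_nonneg measureReal_nonneg]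
    refine hm.trans (le_of_eq ?_)
    have hm' : (0 : ℝ) < m := by exact_mod_cast hm0
    rw [neg_mul, Real.exp_neg, mul_comm, Real.exp_mul, Real.exp_log hm']
    norm_num
  refine ae_eventually_notMem ?_
  have := hsum.tsum_ofReal_ne_top
  simpa [ofReal_measureReal] using this

end Chernoff

/-! ### Ball counts, monotonicity in the generation, and almost sure finiteness of the height -/

section Counts

variable {K : ℕ} {Ω : Type*} {Y : ℕ → ℕ → Ω → Fin K}

theorem ballCount_eq_sum_indicator (m : ℕ) {n : ℕ} (u : Fin n → Fin K) (ω : Ω) :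
    (ballCount Y m u ω : ℝ) = (∑ b ∈ Finset.range m,
      {ω | ∀ k : Fin n, Y b (k + 1) ω = u k}.indicator fun _ => (1 : ℝ)) ω := by
  rw [ballCount, Finset.sum_apply, Finset.card_filter]
  push_cast
  refine Finset.sum_congr rfl fun b _ => ?_
  simp [Set.indicator_apply]

/-- Boxes are nested, so testing a single generation bounds the height from above or below. -/
theorem lowGenerations_mono {m : ℕ} {j : ℝ} {ω : Ω} {n n' : ℕ} (hn : n ∈ lowGenerations Y m j ω)
    (h : n ≤ n') : n' ∈ lowGenerations Y m j ω := by
  intro u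
  refine lt_of_le_of_lt ?_ (hn fun k => u (Fin.castLE h k))
  have hsub : ballCount Y m u ω ≤ ballCount Y m (fun k : Fin n => u (Fin.castLE h k)) ω := by
    refine Finset.card_le_card fun b hb => ?_
    rw [Finset.mem_filter] at hb ⊢
    exact ⟨hb.1, fun k => hb.2 (Fin.castLE h k)⟩
  exact_mod_cast hsub

theorem height_le {m : ℕ} {j : ℝ} {ω : Ω} {n : ℕ} (hn : n ∈ lowGenerations Y m j ω) :
    height Y m j ω ≤ n := Nat.sInf_le hn

/-- Nonemptiness matters: the infimum of the empty set is 0. -/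
theorem lt_height {m : ℕ} {j : ℝ} {ω : Ω} {n : ℕ} (hne : (lowGenerations Y m j ω).Nonempty)
    (hn : n ∉ lowGenerations Y m j ω) : n < height Y m j ω := by
  by_contra! hle
  exact hn (lowGenerations_mono (Nat.sInf_mem hne) hle)

variable [MeasurableSpace Ω] {μ : Measure Ω}

theorem measurableSet_box {X : ℕ → Ω → Fin K} (hX : ∀ n, Measurable (X n)) {n : ℕ}
    (u : Fin n → Fin K) : MeasurableSet {ω | ∀ k : Fin n, X (k + 1) ω = u k} := by
  simp only [Set.ofPred_forall]
  exact MeasurableSet.iInter fun k => hX _ (measurableSet_singleton (u k))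

theorem iIndepFun_box_indicator (hind : iIndepFun (fun (b : ℕ) (ω : Ω) (k : ℕ) => Y b k ω) μ)
    {n : ℕ} (u : Fin n → Fin K) :
    iIndepFun (fun b => {ω | ∀ k : Fin n, Y b (k + 1) ω = u k}.indicator fun _ => (1 : ℝ)) μ := by
  have hmeas : MeasurableSet {x : ℕ → Fin K | ∀ k : Fin n, x (k + 1) = u k} :=
    measurableSet_box (X := fun n (x : ℕ → Fin K) => x n) (fun n => measurable_pi_apply n) u
  have := hind.comp (fun _ => {x : ℕ → Fin K | ∀ k : Fin n, x (k + 1) = u k}.indicator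
    fun _ => (1 : ℝ)) fun _ => measurable_const.indicator hmeas
  exact this

variable [IsProbabilityMeasure μ]

/-- Two balls are almost surely separated. -/
theorem ae_exists_ne (hmeas : ∀ b n, Measurable (Y b n))
    (hind : iIndepFun (fun (b : ℕ) (ω : Ω) (k : ℕ) => Y b k ω) μ) {c l : ℝ} (hl0 : 0 ≤ l) (hl1 : l < 1)
    (hc : ∀ b n, ∀ u : Fin n → Fin K, μ.real {ω | ∀ k : Fin n, Y b (k + 1) ω = u k} ≤ c * l ^ n)
    {b b' : ℕ} (hbb : b ≠ b') : ∀ᵐ ω ∂μ, ∃ k, Y b (k + 1) ω ≠ Y b' (k + 1) ω := by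
  rw [ae_iff]
  simp only [not_exists, not_not]
  set S := {ω | ∀ k, Y b (k + 1) ω = Y b' (k + 1) ω} with hS
  -- Two balls share a box of generation n with probability Σ_u P_b(u) P_b'(u) ≤ max_u P_b(u) ≤ c
  -- l^n.
  have hbound : ∀ n, μ.real S ≤ c * l ^ n := by
    intro n
    set F : ℕ → (Fin n → Fin K) → Set Ω := fun b u => {ω | ∀ k : Fin n, Y b (k + 1) ω = u k} with hF
    have hFm : ∀ b u, MeasurableSet (F b u) := fun b u => measurableSet_box (hmeas b) u
    have hprod : ∀ u, μ.real (F b u ∩ F b' u) = μ.real (F b u) * μ.real (F b' u) := by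
      intro u
      have hm : MeasurableSet {x : ℕ → Fin K | ∀ k : Fin n, x (k + 1) = u k} :=
        measurableSet_box (X := fun n (x : ℕ → Fin K) => x n) (fun n => measurable_pi_apply n) u
      have := (hind.indepFun hbb).measure_inter_preimage_eq_mul _ _ hm hm
      rw [measureReal_def, measureReal_def, measureReal_def, ← ENNReal.toReal_mul]
      exact congrArg ENNReal.toReal this
    have hsub : S ⊆ ⋃ u ∈ (Finset.univ : Finset (Fin n → Fin K)), F b u ∩ F b' u := by
      intro ω hω
      simp only [Finset.mem_univ, Set.iUnion_true, Set.mem_iUnion]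
      exact ⟨fun k => Y b (k + 1) ω, fun k => rfl, fun k => (hω k).symm⟩
    have hsum : ∑ u, μ.real (F b' u) ≤ 1 := by
      rw [← measureReal_biUnion_finset _ fun u _ => hFm b' u]
      · exact measureReal_le_one
      · intro u _ v _ huv
        refine Set.disjoint_left.2 fun ω hu hv => huv (funext fun k => ?_)
        rw [← hu k, ← hv k]
    have hcl : 0 ≤ c * l ^ n := (measureReal_nonneg).trans (hc b n fun k => Y b 0 (Classical.choice
      μ.nonempty_of_neZero))
    calc μ.real S ≤ μ.real (⋃ u ∈ (Finset.univ : Finset (Fin n → Fin K)), F b u ∩ F b' u) :=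
          measureReal_mono hsub (measure_ne_top _ _)
      _ ≤ ∑ u, μ.real (F b u ∩ F b' u) := measureReal_biUnion_finset_le _ _
      _ ≤ ∑ u, c * l ^ n * μ.real (F b' u) := by
          refine Finset.sum_le_sum fun u _ => ?_
          rw [hprod]
          exact mul_le_mul_of_nonneg_right (hc b n u) measureReal_nonneg
      _ ≤ c * l ^ n := by
          rw [← Finset.mul_sum]
          exact mul_le_of_le_one_right hcl hsum
  have hlim : Tendsto (fun n : ℕ => c * l ^ n) atTop (𝓝 0) := by
    simpa using (tendsto_pow_atTop_nhds_zero_of_lt_one hl0 hl1).const_mul c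
  have h0 : μ.real S ≤ 0 := ge_of_tendsto' hlim hbound
  exact (measureReal_eq_zero_iff).1 (h0.antisymm measureReal_nonneg)

/-- Past the separation times of all pairs among the first m balls, no box holds two of them. Only
countably many pairs occur, so one null set serves all m and j. -/
theorem ae_lowGenerations_nonempty (hmeas : ∀ b n, Measurable (Y b n))
    (hind : iIndepFun (fun (b : ℕ) (ω : Ω) (k : ℕ) => Y b k ω) μ) {c l : ℝ} (hl0 : 0 ≤ l) (hl1 : l < 1)
    (hc : ∀ b n, ∀ u : Fin n → Fin K, μ.real {ω | ∀ k : Fin n, Y b (k + 1) ω = u k} ≤ c * l ^ n) :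
    ∀ᵐ ω ∂μ, ∀ (m : ℕ) (j : ℝ), 1 < j → (lowGenerations Y m j ω).Nonempty := by
  have hall : ∀ᵐ ω ∂μ, ∀ b b', b ≠ b' → ∃ k, Y b (k + 1) ω ≠ Y b' (k + 1) ω := by
    rw [ae_all_iff]
    intro b
    rw [ae_all_iff]
    intro b'
    by_cases hbb : b = b'
    · simp [hbb]
    · filter_upwards [ae_exists_ne hmeas hind hl0 hl1 hc hbb] with ω hω _
      exact hω
  filter_upwards [hall] with ω hω m j hj
  choose! f hf using hω
  set n := ∑ b ∈ Finset.range m, ∑ b' ∈ Finset.range m, (f b b' + 1) with hn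
  refine ⟨n, fun u => lt_of_le_of_lt ?_ hj⟩
  have : ballCount Y m u ω ≤ 1 := by
    refine Finset.card_le_one.2 fun b hb b' hb' => ?_
    rw [Finset.mem_filter] at hb hb'
    by_contra hne
    refine hf b b' hne ?_
    have hlt : f b b' < n := by
      have h1 : f b b' + 1 ≤ ∑ b' ∈ Finset.range m, (f b b' + 1) :=
        Finset.single_le_sum (f := fun b' => f b b' + 1) (fun _ _ => Nat.zero_le _) hb'.1
      have h2 : ∑ b' ∈ Finset.range m, (f b b' + 1) ≤ n :=
        Finset.single_le_sum (f := fun b => ∑ b' ∈ Finset.range m, (f b b' + 1))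
          (fun _ _ => Nat.zero_le _) hb.1
      omega
    rw [hb.2 ⟨_, hlt⟩, hb'.2 ⟨_, hlt⟩]
  exact_mod_cast this

end Counts

/-! ### Asymptotics of the height -/

section Height

theorem eventually_add_sub_rpow_le (A B C : ℝ) {β γ D : ℝ} (hγ : 0 < γ) (hβ : β < γ) (hD : 0 < D) :
    ∀ᶠ m : ℕ in atTop,
      A + B * Real.log m + C * (m : ℝ) ^ β - D * (m : ℝ) ^ γ ≤ -2 * Real.log m := by
  have h1 : (fun _ : ℝ => A) =o[atTop] fun x : ℝ => x ^ γ :=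
    Asymptotics.isLittleO_const_left.2 (Or.inr (tendsto_norm_atTop_atTop.comp (tendsto_rpow_atTop hγ)))
  have h2 : (fun x : ℝ => (B + 2) * Real.log x) =o[atTop] fun x : ℝ => x ^ γ :=
    (isLittleO_log_rpow_atTop hγ).const_mul_left _
  have h3 : (fun x : ℝ => C * x ^ β) =o[atTop] fun x : ℝ => x ^ γ := by
    refine Asymptotics.IsLittleO.const_mul_left ?_ C
    refine Asymptotics.isLittleO_of_tendsto' ?_ ?_
    · filter_upwards [eventually_gt_atTop (0 : ℝ)] with x hx h0
      exact absurd h0 (Real.rpow_pos_of_pos hx γ).ne'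
    · refine (tendsto_rpow_neg_atTop (sub_pos.2 hβ)).congr' ?_
      filter_upwards [eventually_gt_atTop (0 : ℝ)] with x hx
      rw [← Real.rpow_sub hx, neg_sub]
  have h := ((h1.add h2).add h3).def hD
  filter_upwards [tendsto_natCast_atTop_atTop.eventually h] with m hm
  have h4 : 0 ≤ (m : ℝ) ^ γ := Real.rpow_nonneg (Nat.cast_nonneg m) γ
  rw [Real.norm_of_nonneg h4] at hm
  have := (le_abs_self _).trans hm
  linarith

variable {K : ℕ} {Ω : Type*} {Y : ℕ → ℕ → Ω → Fin K} [MeasurableSpace Ω] {μ : Measure Ω}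
  [IsProbabilityMeasure μ]

/-- At this generation every box has mean at most c m^(1-β), negligible against m^α since 1 - β < α;
the union bound costs a factor polynomial in m. -/
theorem ae_eventually_mem_lowGenerations [NeZero K] (hmeas : ∀ b n, Measurable (Y b n))
    (hind : iIndepFun (fun (b : ℕ) (ω : Ω) (k : ℕ) => Y b k ω) μ) {c l : ℝ} (hc0 : 0 < c)
    (hl0 : 0 < l) (hl1 : l < 1)
    (hc : ∀ b n, ∀ u : Fin n → Fin K, μ.real {ω | ∀ k : Fin n, Y b (k + 1) ω = u k} ≤ c * l ^ n)
    {α β : ℝ} (hα : 0 < α) (hα1 : α < 1) (hβ : 1 - α < β) :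
    ∀ᵐ ω ∂μ, ∀ᶠ m : ℕ in atTop,
      ⌈β * Real.log m / (-Real.log l)⌉₊ ∈ lowGenerations Y m ((m : ℝ) ^ α) ω := by
  have hL : 0 < -Real.log l := neg_pos.2 (Real.log_neg hl0 hl1)
  set L := -Real.log l with hLdef
  suffices h : ∀ᵐ ω ∂μ, ∀ᶠ m : ℕ in atTop,
      ω ∉ {ω | ⌈β * Real.log m / L⌉₊ ∉ lowGenerations Y m ((m : ℝ) ^ α) ω} by
    filter_upwards [h] with ω hω
    filter_upwards [hω] with m hm
    exact not_not.1 hm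
  refine ae_eventually_notMem_of_le_exp ?_
  have hKpos : (0 : ℝ) < K := by exact_mod_cast NeZero.pos K
  have hK : 0 ≤ Real.log K := Real.log_nonneg (by exact_mod_cast NeZero.one_le)
  filter_upwards [eventually_add_sub_rpow_le (Real.log K) (Real.log K * β / L) (2 * c)
    (β := 1 - β) hα (by linarith) one_pos, eventually_gt_atTop 0,
    (tendsto_natCast_atTop_atTop (R := ℝ)).eventually (eventually_ge_atTop 1)] with m hm hm0 hm1
  refine le_trans ?_ (Real.exp_le_exp.2 hm)
  have hmpos : (0 : ℝ) < m := by exact_mod_cast hm0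
  set n := ⌈β * Real.log m / L⌉₊ with hn
  have hsub : {ω | n ∉ lowGenerations Y m ((m : ℝ) ^ α) ω} ⊆
      ⋃ u ∈ (Finset.univ : Finset (Fin n → Fin K)), {ω | (m : ℝ) ^ α ≤ (∑ b ∈ Finset.range m,
        {ω | ∀ k : Fin n, Y b (k + 1) ω = u k}.indicator fun _ => (1 : ℝ)) ω} := by
    intro ω hω
    have hω' : ¬ ∀ u : Fin n → Fin K, (ballCount Y m u ω : ℝ) < (m : ℝ) ^ α := hω
    push Not at hω'
    obtain ⟨u, hu⟩ := hω'
    simp only [Finset.mem_univ, Set.iUnion_true, Set.mem_iUnion]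
    refine ⟨u, ?_⟩
    rw [ballCount_eq_sum_indicator] at hu
    exact hu
  have hnL : β * Real.log m ≤ n * L := by
    rw [← div_le_iff₀ hL]
    exact Nat.le_ceil _
  have hln : m * l ^ n ≤ (m : ℝ) ^ (1 - β) := by
    rw [← Real.rpow_natCast, Real.rpow_def_of_pos hl0, Real.rpow_def_of_pos hmpos]
    nth_rewrite 1 [← Real.exp_log hmpos]
    rw [← Real.exp_add, Real.exp_le_exp]
    have : Real.log l = -L := by rw [hLdef, neg_neg]
    rw [this]
    linarith
  have hKn : (K : ℝ) ^ n ≤ Real.exp (Real.log K + (Real.log K * β / L) * Real.log m) := by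
    rw [← Real.rpow_natCast, Real.rpow_def_of_pos hKpos, Real.exp_le_exp]
    have hnle : (n : ℝ) ≤ β * Real.log m / L + 1 := (Nat.ceil_lt_add_one
      (div_nonneg (mul_nonneg (by linarith) (Real.log_nonneg hm1)) hL.le)).le
    refine (mul_le_mul_of_nonneg_left hnle hK).trans (le_of_eq ?_)
    ring
  calc μ.real {ω | n ∉ lowGenerations Y m ((m : ℝ) ^ α) ω}
      ≤ ∑ u : Fin n → Fin K, μ.real {ω | (m : ℝ) ^ α ≤ (∑ b ∈ Finset.range m,
        {ω | ∀ k : Fin n, Y b (k + 1) ω = u k}.indicator fun _ => (1 : ℝ)) ω} :=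
        (measureReal_mono hsub (measure_ne_top _ _)).trans (measureReal_biUnion_finset_le _ _)
    _ ≤ ∑ u : Fin n → Fin K, Real.exp (-(m : ℝ) ^ α + 2 * (m * (c * l ^ n))) :=
        Finset.sum_le_sum fun u _ => measure_sum_indicator_ge_le
          (fun b => measurableSet_box (hmeas b) u) (iIndepFun_box_indicator hind u) m
          (fun b => hc b n u) _
    _ = (K : ℝ) ^ n * Real.exp (-(m : ℝ) ^ α + 2 * (m * (c * l ^ n))) := by simp
    _ ≤ Real.exp (Real.log K + (Real.log K * β / L) * Real.log m) *
          Real.exp (-(m : ℝ) ^ α + 2 * c * (m : ℝ) ^ (1 - β)) := by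
        refine mul_le_mul hKn (Real.exp_le_exp.2 ?_) (Real.exp_nonneg _) (Real.exp_nonneg _)
        nlinarith [mul_le_mul_of_nonneg_left hln hc0.le]
    _ = _ := by
        rw [← Real.exp_add]
        congr 1
        ring

/-- Here the heavy box alone has mean at least c m^(1-β), far above m^α, so no union bound is
needed. -/
theorem ae_eventually_notMem_lowGenerations (hmeas : ∀ b n, Measurable (Y b n))
    (hind : iIndepFun (fun (b : ℕ) (ω : Ω) (k : ℕ) => Y b k ω) μ) {c l : ℝ} (hc0 : 0 < c)
    (hl0 : 0 < l) (hl1 : l < 1)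
    (hc : ∀ n, ∃ u : Fin n → Fin K, ∀ b, c * l ^ n ≤ μ.real {ω | ∀ k : Fin n, Y b (k + 1) ω = u k})
    {α β : ℝ} (hα : 0 < α) (hβ0 : 0 ≤ β) (hβ : β < 1 - α) :
    ∀ᵐ ω ∂μ, ∀ᶠ m : ℕ in atTop,
      ⌊β * Real.log m / (-Real.log l)⌋₊ ∉ lowGenerations Y m ((m : ℝ) ^ α) ω := by
  have hL : 0 < -Real.log l := neg_pos.2 (Real.log_neg hl0 hl1)
  set L := -Real.log l with hLdef
  suffices h : ∀ᵐ ω ∂μ, ∀ᶠ m : ℕ in atTop,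
      ω ∉ {ω | ⌊β * Real.log m / L⌋₊ ∈ lowGenerations Y m ((m : ℝ) ^ α) ω} from h
  refine ae_eventually_notMem_of_le_exp ?_
  filter_upwards [eventually_add_sub_rpow_le 0 0 1 (β := α) (γ := 1 - β) (D := c / 2) (by linarith)
    (by linarith) (by linarith), eventually_gt_atTop 0,
    (tendsto_natCast_atTop_atTop (R := ℝ)).eventually (eventually_ge_atTop 1)] with m hm hm0 hm1
  refine le_trans ?_ (Real.exp_le_exp.2 hm)
  have hmpos : (0 : ℝ) < m := by exact_mod_cast hm0
  set n := ⌊β * Real.log m / L⌋₊ with hn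
  obtain ⟨u, hu⟩ := hc n
  have hsub : {ω | n ∈ lowGenerations Y m ((m : ℝ) ^ α) ω} ⊆
      {ω | (∑ b ∈ Finset.range m,
        {ω | ∀ k : Fin n, Y b (k + 1) ω = u k}.indicator fun _ => (1 : ℝ)) ω ≤ (m : ℝ) ^ α} := by
    intro ω hω
    have hω' : ∀ u : Fin n → Fin K, (ballCount Y m u ω : ℝ) < (m : ℝ) ^ α := hω
    have := (hω' u).le
    rw [ballCount_eq_sum_indicator] at this
    exact this
  have hnL : n * L ≤ β * Real.log m := by
    rw [← le_div_iff₀ hL]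
    exact Nat.floor_le (div_nonneg (mul_nonneg hβ0 (Real.log_nonneg hm1)) hL.le)
  have hln : (m : ℝ) ^ (1 - β) ≤ m * l ^ n := by
    rw [← Real.rpow_natCast, Real.rpow_def_of_pos hl0, Real.rpow_def_of_pos hmpos]
    nth_rewrite 2 [← Real.exp_log hmpos]
    rw [← Real.exp_add, Real.exp_le_exp]
    have : Real.log l = -L := by rw [hLdef, neg_neg]
    rw [this]
    linarith
  refine (measureReal_mono hsub (measure_ne_top _ _)).trans ?_
  refine (measure_sum_indicator_le_le (fun b => measurableSet_box (hmeas b) u)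
    (iIndepFun_box_indicator hind u) m hu _).trans (Real.exp_le_exp.2 ?_)
  nlinarith [mul_le_mul_of_nonneg_left hln hc0.le]

theorem ae_tendsto_height [NeZero K] (hmeas : ∀ b n, Measurable (Y b n))
    (hind : iIndepFun (fun (b : ℕ) (ω : Ω) (k : ℕ) => Y b k ω) μ) {c l : ℝ} (hc0 : 0 < c)
    (hl0 : 0 < l) (hl1 : l < 1)
    (hc : ∀ b n, ∀ u : Fin n → Fin K, μ.real {ω | ∀ k : Fin n, Y b (k + 1) ω = u k} ≤ c * l ^ n)
    (hc' : ∀ n, ∃ u : Fin n → Fin K, ∀ b,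
      c⁻¹ * l ^ n ≤ μ.real {ω | ∀ k : Fin n, Y b (k + 1) ω = u k})
    {α : ℝ} (hα : 0 < α) (hα1 : α < 1) :
    ∀ᵐ ω ∂μ, (∀ m : ℕ, 2 ≤ m → (lowGenerations Y m ((m : ℝ) ^ α) ω).Nonempty) ∧
      Tendsto (fun m : ℕ => (height Y m ((m : ℝ) ^ α) ω : ℝ) / Real.log m) atTop
        (𝓝 ((1 - α) * (-Real.log l)⁻¹)) := by
  have hL : 0 < -Real.log l := neg_pos.2 (Real.log_neg hl0 hl1)
  -- A countable sequence of margins keeps the exceptional set null; ε_k ≤ 1 - α keeps the lower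
  -- exponent nonnegative.
  set ε : ℕ → ℝ := fun k => (1 - α) * (1 / ((k : ℝ) + 1)) with hε
  have hε0 : ∀ k, 0 < ε k := fun k => mul_pos (by linarith) (by positivity)
  have hε1 : ∀ k, ε k ≤ 1 - α := fun k => by
    refine mul_le_of_le_one_right (by linarith) ?_
    rw [div_le_one (by positivity)]
    linarith [Nat.cast_nonneg (α := ℝ) k]
  have hεlim : Tendsto ε atTop (𝓝 0) := by
    have := (tendsto_one_div_add_atTop_nhds_zero_nat (𝕜 := ℝ)).const_mul (1 - α)
    rwa [mul_zero] at this
  have hup := ae_all_iff.2 fun k => ae_eventually_mem_lowGenerations hmeas hind hc0 hl0 hl1 hc hα hα1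
    (β := 1 - α + ε k) (by linarith [hε0 k])
  have hlo := ae_all_iff.2 fun k => ae_eventually_notMem_lowGenerations hmeas hind (inv_pos.2 hc0)
    hl0 hl1 hc' hα (β := 1 - α - ε k) (by linarith [hε1 k]) (by linarith [hε0 k])
  filter_upwards [ae_lowGenerations_nonempty hmeas hind hl0.le hl1 hc, hup, hlo] with ω hne hup hlo
  have hne' : ∀ m : ℕ, 2 ≤ m → (lowGenerations Y m ((m : ℝ) ^ α) ω).Nonempty := fun m hm =>
    hne m _ (Real.one_lt_rpow (by exact_mod_cast hm) hα)
  refine ⟨hne', ?_⟩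
  set L := -Real.log l with hLdef
  have hlog : Tendsto (fun m : ℕ => Real.log m) atTop atTop :=
    Real.tendsto_log_atTop.comp tendsto_natCast_atTop_atTop
  rw [Metric.tendsto_atTop']
  intro δ hδ
  obtain ⟨k, hk⟩ := (hεlim.eventually (gt_mem_nhds (show 0 < δ / 2 * L by positivity))).exists
  refine eventually_atTop.1 ?_ |>.imp fun N hN n hn => hN n hn.le
  -- Once log m > 2/δ, the rounding error of one generation is less than (δ/2) log m.
  filter_upwards [hup k, hlo k, hlog.eventually_gt_atTop (2 / δ), eventually_ge_atTop 2]
    with m hm1 hm2 hm3 hm4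
  have hlogpos : 0 < Real.log m := lt_trans (by positivity) hm3
  have h1 : (height Y m ((m : ℝ) ^ α) ω : ℝ) ≤ (1 - α + ε k) * Real.log m / L + 1 := by
    refine le_trans ?_ (Nat.ceil_lt_add_one (div_nonneg (mul_nonneg (by linarith [hε0 k])
      hlogpos.le) hL.le)).le
    exact_mod_cast height_le hm1
  have h2 : (1 - α - ε k) * Real.log m / L - 1 ≤ (height Y m ((m : ℝ) ^ α) ω : ℝ) := by
    have := lt_height (hne' m hm4) hm2
    have h3 := Nat.lt_floor_add_one ((1 - α - ε k) * Real.log m / L)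
    have h4 : (⌊(1 - α - ε k) * Real.log m / L⌋₊ : ℝ) ≤ height Y m ((m : ℝ) ^ α) ω := by
      exact_mod_cast this.le
    linarith
  have h3 : 1 < δ / 2 * Real.log m := by
    rw [div_lt_iff₀ hδ] at hm3
    linarith
  have h4 : ε k * Real.log m / L < δ / 2 * Real.log m := by
    rw [div_lt_iff₀ hL]
    nlinarith
  rw [Real.dist_eq, abs_lt]
  have e1 : (1 - α + ε k) * Real.log m / L = (1 - α) * L⁻¹ * Real.log m + ε k * Real.log m / L := by
    ring
  have e2 : (1 - α - ε k) * Real.log m / L = (1 - α) * L⁻¹ * Real.log m - ε k * Real.log m / L := by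
    ring
  constructor
  · rw [lt_sub_iff_add_lt, lt_div_iff₀ hlogpos]
    linarith
  · rw [sub_lt_iff_lt_add, div_lt_iff₀ hlogpos]
    linarith

end Height

theorem theorem2 {K : ℕ} (hK : 2 ≤ K) (p : Matrix (Fin K) (Fin K) ℝ)
    (hp : p ∈ Matrix.rowStochastic ℝ (Fin K)) (hirr : p.IsIrreducible) (haper : IsAperiodic p)
    (s : Fin K) :
    ∃ (ρ : ℝ → ℝ) (C : ℝ),
      (∀ θ : ℝ, IsMaxModulusEigenvalue (powMatrix p θ) (ρ θ)) ∧
      Differentiable ℝ ρ ∧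
      0 < C ∧
      Tendsto (fun θ : ℝ => ρ θ / (-deriv ρ θ)) atTop (𝓝 C) ∧
      ∀ {Ω : Type*} [MeasurableSpace Ω] (μ : Measure Ω) [IsProbabilityMeasure μ]
        (Y : ℕ → ℕ → Ω → Fin K),
        (∀ b : ℕ, IsMarkovChainFrom μ p s (Y b)) →
        iIndepFun (fun (b : ℕ) (ω : Ω) (k : ℕ) => Y b k ω) μ →
        ∀ α : ℝ, 0 < α → α < 1 →
          ∀ᵐ ω ∂μ,
            (∀ m : ℕ, 2 ≤ m → (lowGenerations Y m ((m : ℝ) ^ α) ω).Nonempty) ∧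
            Tendsto (fun m : ℕ => (height Y m ((m : ℝ) ^ α) ω : ℝ) / Real.log m) atTop
              (𝓝 ((1 - α) * C)) := by
  have : NeZero K := ⟨by omega⟩
  have hprim : p.IsPrimitive := isPrimitive_of_isAperiodic hirr haper
  have hA := powMatrix_isPrimitive hprim
  choose x hx ρ hρ using fun θ => (hA θ).exists_eigenvector
  obtain ⟨l, h, hl, hh, hle, ht⟩ := exists_maxTimes_eigenvector hprim
  have hl1 : l < 1 := maxTimes_eigenvalue_lt_one hK hprim hp hh ht
  refine ⟨ρ, (-Real.log l)⁻¹, fun θ => (hA θ).charpoly_perron (hx θ) (hρ θ),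
    differentiable_perron_root hA (powMatrix_differentiable hprim.nonneg) hx hρ,
    inv_pos.2 (neg_pos.2 (Real.log_neg hl hl1)),
    tendsto_perron_root_div_deriv hprim hl hl1 hh hle ht hx hρ, ?_⟩
  intro Ω _ μ _ Y hY hind α hα hα1
  obtain ⟨c, hc0, hc⟩ := exists_box_bounds (μ := μ) hprim.nonneg hl hh hle ht s
  refine ae_tendsto_height (fun b => (hY b).measurable) hind hc0 hl hl1
    (fun b n => (hc n).1 (Y b) (hY b)) (fun n => ?_) hα hα1
  obtain ⟨u, hu⟩ := (hc n).2
  exact ⟨u, fun b => hu (Y b) (hY b)⟩
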